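/- Let $p$ and $q$ be odd primes with $p \mid q-1$, and let $G = C_q \rtimes C_p$ be the non-abelian group of order $pq$, with commutator subgroup $G' \cong C_q$. A sequence $S$ over $G$ is a finite multiset of elements of $G$. It is called product-one if its terms, each used exactly once, can be ordered so that their product is $1$, and minimal product-one if it is product-one and is not the union (with multiplicities) of two nonempty product-one sequences. Let $S$ be a sequence over $G$ of length $|S| = 2q$. If at least three terms of $S$, counted with multiplicity, lie in $G \setminus G'$, then $S$ is not a minimal product-one sequence. Equivalently, if $S$ is a minimal product-one sequence of length $2q$, then at most two terms of $S$, counted with multiplicity, lie in $G \setminus G'$. -/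

import Mathlib

/-- The set of products `π(S)` of a sequence `S` over `G` (a finite multiset of elements of `G`):
all products of the terms of `S`, each used exactly once, taken in any order. -/
def productSet {G : Type*} [Group G] (S : Multiset G) : Set G :=
  {g | ∃ l : List G, (l : Multiset G) = S ∧ l.prod = g}

/-- A sequence is product-one if its terms can be ordered so that their product is `1`. -/
def IsProductOne {G : Type*} [Group G] (S : Multiset G) : Prop :=
  (1 : G) ∈ productSet S

/-- A sequence is minimal product-one if it is product-one and is not the concatenation of two
nontrivial product-one sequences. -/
def IsMinimalProductOne {G : Type*} [Group G] (S : Multiset G) : Prop :=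
  IsProductOne S ∧
    ∀ T₁ T₂ : Multiset G, T₁ ≠ 0 → T₂ ≠ 0 → IsProductOne T₁ → IsProductOne T₂ → S ≠ T₁ + T₂

open Classical in
/-- The number `v_K(S)` of terms of the sequence `S` that lie in `K`, counted with multiplicity. -/
noncomputable def numTermsIn {G : Type*} (K : Set G) (S : Multiset G) : ℕ :=
  S.countP (fun g => g ∈ K)

/-!
The group is `ZMod q ⋊ ZMod p`, with product `(c, i) * (d, j) = (c + χ i * d, i + j)` for an
injective character `χ : ZMod p → (ZMod q)ˣ`, and its commutator subgroup consists of the pairs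
`(c, 0)` (`exists_coordinates`, `mem_commutator_iff`). The *twist* of a sequence is the sum of its
second coordinates. A sequence is product-one if and only if its twist vanishes and `0` lies in the
set `Pr` of the first coordinates of its products. A sequence of twist zero is hence product-one as
soon as `Pr` is all of `ZMod q`. A product-one sequence `S` of length `2 * q` is split into two by
finding a product-one sub-sequence whose complement, which has twist zero automatically, attains
all products.

An element of non-zero twist acts on `ZMod q` as an affine map with one fixed point, its *colour*;
elements other than `1` commute if and only if they have the same colour, where those of twist zero
have the colour `none`. The main tools for making `Pr` large are the following.

* Each pair of non-commuting terms adds *two* products (`card_Pr_add_pair`). If it added only one,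
  then `Pr` would be an arithmetic progression, with several differences at once, and this leads
  to an equality `χ i = -1`, `± 2 * (± 2) = 1` or the like, which cannot hold since `χ` takes
  values of odd order and `q ≥ 7`. Three elements of different finite colours have at least four
  products (`four_le_card_triple`). By a greedy matching of the colours (`exists_pairs`,
  `exists_rainbow_triple`), about `q` terms with no dominating colour attain all products.
* Terms of twist zero can be inserted anywhere in a product, so each of them adds as many products
  as there are twists of prefixes to choose from, less one (`card_Pr_of_prefixes`).
* By the Erdős–Ginzburg–Ziv theorem, the terms of non-zero twist contain blocks of length `p` and
  twist zero, each of which is product-one or has at least `p` products. Blocks and terms of twist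
  zero of total length `q` contain a product-one sequence, by Cauchy–Davenport
  (`exists_PO_le_sum`).

This proves `exists_split`. If a finite colour `z` is used by more than half of the terms, a short
zero-sum sequence of colour `z` is split off. If the remaining terms of other colours are too few
for the methods above, then the numerous terms of colour `z` control the others completely: after
moving the fixed point `z` to `0`, every product of the whole sequence is one of the complement
(`exists_split_of_popular`). Otherwise, if a proper part of the terms of non-zero twist has one
colour and twist zero, it is split off and the complement attains all products. If there is no such
part, every colour occurs at most `p - 1` times or there are only few terms of non-zero twist. Then
a product-one sequence is found among `q` terms made up from blocks and terms of twist zero, and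
the `q` others attain all products (`Pr_univ_of_few_colors`, `Pr_univ_of_three_prefixes`). Without
terms of twist zero the blocks have `q - 1` terms in total; both they and the other `q + 1` terms
attain all products.
-/

open scoped Pointwise

namespace SemidirectSeq

set_option linter.unusedSectionVars false

/-! ### Sequences over `ZMod q ⋊ ZMod p` and their product sets -/

section Basic

/-- The elements of the semidirect product `ZMod q ⋊ ZMod p`, as pairs. -/
abbrev Elt (p q : ℕ) := ZMod q × ZMod p

variable {p q : ℕ} [Fact p.Prime] [Fact q.Prime] {χ : AddChar (ZMod p) (ZMod q)}

/-- The first coordinate of the product of a list in `ZMod q ⋊ ZMod p`, where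
`(c, i) * (d, j) = (c + χ i * d, i + j)`. -/
def ev (χ : AddChar (ZMod p) (ZMod q)) : List (Elt p q) → ZMod q
  | [] => 0
  | g :: l => g.1 + χ g.2 * ev χ l

/-- The twist of a sequence over `ZMod q ⋊ ZMod p`: the second coordinate of all its products. -/
def tw (S : Multiset (Elt p q)) : ZMod p := (S.map Prod.snd).sum

open Classical in
/-- The set of first coordinates of the products of a sequence over `ZMod q ⋊ ZMod p`. -/
noncomputable def Pr (χ : AddChar (ZMod p) (ZMod q)) (S : Multiset (Elt p q)) :
    Finset (ZMod q) :=
  Finset.univ.filter fun x => ∃ l : List (Elt p q), (l : Multiset _) = S ∧ ev χ l = x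

/-- A sequence over `ZMod q ⋊ ZMod p` is product-one: some ordering has product `(0, 0)`. -/
def PO (χ : AddChar (ZMod p) (ZMod q)) (S : Multiset (Elt p q)) : Prop :=
  tw S = 0 ∧ (0 : ZMod q) ∈ Pr χ S

lemma mem_Pr {S : Multiset (Elt p q)} {x : ZMod q} :
    x ∈ Pr χ S ↔ ∃ l : List (Elt p q), (l : Multiset _) = S ∧ ev χ l = x := by
  classical
  simp [Pr]

@[simp] lemma ev_nil : ev χ [] = 0 := rfl

@[simp] lemma ev_cons (g : Elt p q) (l : List (Elt p q)) :
    ev χ (g :: l) = g.1 + χ g.2 * ev χ l := rfl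

@[simp] lemma tw_zero : tw (0 : Multiset (Elt p q)) = 0 := rfl

@[simp] lemma tw_nil : tw (([] : List (Elt p q)) : Multiset (Elt p q)) = 0 := rfl

@[simp] lemma tw_cons (g : Elt p q) (S : Multiset (Elt p q)) :
    tw (g ::ₘ S) = g.2 + tw S := by
  simp [tw]

@[simp] lemma tw_coe_cons (g : Elt p q) (l : List (Elt p q)) :
    tw ((g :: l : List (Elt p q)) : Multiset (Elt p q)) = g.2 + tw (l : Multiset (Elt p q)) := by
  rw [← Multiset.cons_coe, tw_cons]

@[simp] lemma tw_singleton (g : Elt p q) : tw ({g} : Multiset (Elt p q)) = g.2 := by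
  simp [tw]

@[simp] lemma tw_add (S T : Multiset (Elt p q)) : tw (S + T) = tw S + tw T := by
  simp [tw]

@[simp] lemma tw_coe_append (l l' : List (Elt p q)) :
    tw ((l ++ l' : List (Elt p q)) : Multiset (Elt p q)) =
      tw (l : Multiset (Elt p q)) + tw (l' : Multiset (Elt p q)) := by
  rw [← Multiset.coe_add, tw_add]

lemma ev_append (l l' : List (Elt p q)) :
    ev χ (l ++ l') = ev χ l + χ (tw (l : Multiset (Elt p q))) * ev χ l' := by
  induction l with
  | nil => simp
  | cons g l ih =>
    simp only [List.cons_append, ev_cons, ih, tw_coe_cons, AddChar.map_add_eq_mul]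
    ring

lemma chi_mul_neg (i : ZMod p) : χ i * χ (-i) = 1 := by
  rw [← AddChar.map_add_eq_mul]; simp

lemma chi_ne_zero (i : ZMod p) : χ i ≠ 0 := fun h => by
  have := chi_mul_neg (χ := χ) i
  simp [h] at this

lemma chi_eq_one_iff (hχ : Function.Injective χ) {i : ZMod p} : χ i = 1 ↔ i = 0 := by
  constructor
  · intro h; apply hχ; simpa using h
  · rintro rfl; simp

lemma add_self_ne_zero (hp : Odd p) {i : ZMod p} (hi : i ≠ 0) : i + i ≠ 0 := by
  intro h
  rw [← two_mul] at h
  have h1 : ((2 : ℕ) : ZMod p) = 0 := by exact_mod_cast (mul_eq_zero.1 h).resolve_right hi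
  rw [ZMod.natCast_eq_zero_iff] at h1
  have := (Nat.prime_dvd_prime_iff_eq (Fact.out : p.Prime) Nat.prime_two).1 h1
  subst this
  exact absurd hp (by decide)

/-- The values of `χ` have odd order `1` or `p`, whereas `-1` has order `2`. -/
lemma chi_ne_neg_one (hp : Odd p) (hq : Odd q) (hχ : Function.Injective χ) (i : ZMod p) :
    χ i ≠ -1 := by
  intro h
  have h2 : χ (i + i) = 1 := by rw [AddChar.map_add_eq_mul, h]; ring
  rw [chi_eq_one_iff hχ] at h2
  have h3 : i = 0 := by
    by_contra hi
    exact add_self_ne_zero hp hi h2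
  rw [h3, AddChar.map_zero_eq_one] at h
  exact add_self_ne_zero hq one_ne_zero (by linear_combination h : (1 : ZMod q) + 1 = 0)

lemma Pr_nonempty (S : Multiset (Elt p q)) : (Pr χ S).Nonempty :=
  ⟨ev χ S.toList, mem_Pr.2 ⟨S.toList, by simp, rfl⟩⟩

lemma Pr_singleton (g : Elt p q) : Pr χ {g} = {g.1} := by
  ext x
  rw [mem_Pr]
  constructor
  · rintro ⟨l, hl, rfl⟩
    rw [Multiset.coe_eq_singleton] at hl
    simp [hl]
  · intro h
    exact ⟨[g], rfl, by simpa [eq_comm] using h⟩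

lemma add_mem_Pr {A B : Multiset (Elt p q)} {x y : ZMod q} (hx : x ∈ Pr χ A)
    (hy : y ∈ Pr χ B) : x + χ (tw A) * y ∈ Pr χ (A + B) := by
  obtain ⟨l, rfl, rfl⟩ := mem_Pr.1 hx
  obtain ⟨l', rfl, rfl⟩ := mem_Pr.1 hy
  exact mem_Pr.2 ⟨l ++ l', rfl, ev_append _ _⟩

lemma add_mem_Pr' {A B : Multiset (Elt p q)} {x y : ZMod q} (hx : x ∈ Pr χ A)
    (hy : y ∈ Pr χ B) : y + χ (tw B) * x ∈ Pr χ (A + B) := by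
  rw [add_comm A B]; exact add_mem_Pr hy hx

/-- The Cauchy–Davenport theorem, for product sets. -/
lemma card_Pr_add (A B : Multiset (Elt p q)) :
    min q ((Pr χ A).card + (Pr χ B).card - 1) ≤ (Pr χ (A + B)).card := by
  have hinj : Function.Injective fun y : ZMod q => χ (tw A) * y :=
    mul_right_injective₀ (chi_ne_zero _)
  have h := ZMod.cauchy_davenport (Fact.out : q.Prime) (Pr_nonempty (χ := χ) A)
    ((Pr_nonempty (χ := χ) B).image fun y => χ (tw A) * y)
  rw [Finset.card_image_of_injective _ hinj] at h
  refine h.trans (Finset.card_le_card ?_)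
  intro z hz
  obtain ⟨x, hx, y', hy', rfl⟩ := Finset.mem_add.1 hz
  obtain ⟨y, hy, rfl⟩ := Finset.mem_image.1 hy'
  exact add_mem_Pr hx hy

lemma card_Pr_le (A : Multiset (Elt p q)) : (Pr χ A).card ≤ q := by
  simpa [ZMod.card] using Finset.card_le_univ (Pr χ A)

lemma Pr_eq_univ_iff {A : Multiset (Elt p q)} :
    Pr χ A = Finset.univ ↔ q ≤ (Pr χ A).card := by
  constructor
  · intro h; rw [h]; simp [ZMod.card]
  · intro h
    apply Finset.eq_univ_of_card
    rw [ZMod.card]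
    exact le_antisymm (card_Pr_le A) h

lemma card_Pr_mono {A B : Multiset (Elt p q)} (h : A ≤ B) :
    (Pr χ A).card ≤ (Pr χ B).card := by
  obtain ⟨C, rfl⟩ := Multiset.le_iff_exists_add.1 h
  have h1 := card_Pr_add (χ := χ) A C
  have h2 := (Pr_nonempty (χ := χ) C).card_pos
  have h3 := card_Pr_le (χ := χ) A
  omega

lemma Pr_univ_mono {A B : Multiset (Elt p q)} (h : A ≤ B) (hA : Pr χ A = Finset.univ) :
    Pr χ B = Finset.univ := by
  rw [Pr_eq_univ_iff] at *
  exact hA.trans (card_Pr_mono h)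

/-- Terms of twist `0` may be inserted anywhere in a list: if the prefixes of `L` attain the
twists in `A`, each inserted term contributes one of `|A|` values. -/
lemma card_Pr_of_prefixes (hχ : Function.Injective χ) (L : List (Elt p q))
    (A : Finset (ZMod p)) (hAne : A.Nonempty)
    (hA : ∀ α ∈ A, ∃ l₁ l₂, L = l₁ ++ l₂ ∧ tw (l₁ : Multiset (Elt p q)) = α)
    (M : Multiset (Elt p q)) (hM : ∀ g ∈ M, g.2 = 0 ∧ g.1 ≠ 0) :
    min q (1 + M.card * (A.card - 1)) ≤ (Pr χ ((L : Multiset _) + M)).card := by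
  classical
  let Z : Multiset (Elt p q) → Finset (ZMod q) := fun N =>
    Finset.univ.filter fun x => ∃ l : List (Elt p q), (l : Multiset _) = N ∧ ev χ l = x ∧
      ∀ α ∈ A, ∃ l₁ l₂, l = l₁ ++ l₂ ∧ tw (l₁ : Multiset (Elt p q)) = α
  have hZ : ∀ N x, x ∈ Z N ↔ ∃ l : List (Elt p q), (l : Multiset _) = N ∧ ev χ l = x ∧
      ∀ α ∈ A, ∃ l₁ l₂, l = l₁ ++ l₂ ∧ tw (l₁ : Multiset (Elt p q)) = α := by
    intro N x; simp [Z]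
  suffices h : (Z ((L : Multiset _) + M)).Nonempty ∧
      min q (1 + M.card * (A.card - 1)) ≤ (Z ((L : Multiset _) + M)).card by
    refine h.2.trans (Finset.card_le_card fun x hx => ?_)
    obtain ⟨l, h1, h2, -⟩ := (hZ _ _).1 hx
    exact mem_Pr.2 ⟨l, h1, h2⟩
  induction M using Multiset.induction_on with
  | empty =>
    have hne : (Z ((L : Multiset _) + 0)).Nonempty := ⟨ev χ L, (hZ _ _).2 ⟨L, by simp, rfl, hA⟩⟩
    refine ⟨hne, ?_⟩
    have := hne.card_pos
    rw [Multiset.card_zero, zero_mul]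
    exact (min_le_right _ _).trans this
  | cons g M ih =>
    obtain ⟨hne, ih⟩ := ih fun x hx => hM x (Multiset.mem_cons_of_mem hx)
    obtain ⟨hg2, hg1⟩ := hM g (Multiset.mem_cons_self _ _)
    set B : Finset (ZMod q) := A.image fun α => χ α * g.1 with hB
    have hBc : B.card = A.card := Finset.card_image_of_injective _ fun a b h =>
      hχ (mul_right_cancel₀ hg1 h)
    have hsub : Z ((L : Multiset _) + M) + B ⊆ Z ((L : Multiset _) + g ::ₘ M) := by
      intro z hz
      obtain ⟨x, hx, y, hy, rfl⟩ := Finset.mem_add.1 hz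
      obtain ⟨α, hα, rfl⟩ := Finset.mem_image.1 hy
      obtain ⟨l, h1, rfl, h3⟩ := (hZ _ _).1 hx
      obtain ⟨l₁, l₂, rfl, h4⟩ := h3 α hα
      refine (hZ _ _).2 ⟨l₁ ++ g :: l₂, ?_, ?_, ?_⟩
      · rw [Multiset.add_cons, ← h1, ← Multiset.coe_add, ← Multiset.coe_add, ← Multiset.cons_coe,
          Multiset.add_cons]
      · simp only [ev_append, ev_cons, h4, hg2, AddChar.map_zero_eq_one]
        ring
      · intro β hβ
        obtain ⟨m₁, m₂, h5, h6⟩ := h3 β hβ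
        rcases List.append_eq_append_iff.1 h5 with ⟨a, h7, h8⟩ | ⟨a, h7, h8⟩
        · exact ⟨l₁ ++ g :: a, m₂, by simp [h8], by
            rw [← h6, h7]; simp [hg2]⟩
        · exact ⟨m₁, a ++ g :: l₂, by simp [h7], h6⟩
    have hBne : B.Nonempty := hAne.image _
    refine ⟨(hne.add hBne).mono hsub, le_trans ?_ (Finset.card_le_card hsub)⟩
    refine le_trans ?_ (ZMod.cauchy_davenport (Fact.out : q.Prime) hne hBne)
    rw [hBc, Multiset.card_cons]
    have h1 := hAne.card_pos
    have h2 := hne.card_pos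
    have h3 : (M.card + 1) * (A.card - 1) = M.card * (A.card - 1) + (A.card - 1) := by ring
    rw [h3]
    omega

end Basic

/-! ### Adjoining a pair of non-commuting terms -/

section PairGrowth

section Boundary

variable {q : ℕ} [Fact q.Prime]

/-- The number of elements of `E` whose translate by `-d` leaves `E`. For `d ≠ 0` and `E`
neither empty nor everything, it is `1` exactly for the arithmetic progressions with difference
`d`. -/
def bdry (d : ZMod q) (E : Finset (ZMod q)) : ℕ := (E.filter fun x => x - d ∉ E).card

lemma bdry_image {u : ZMod q} (hu : u ≠ 0) (v d : ZMod q) (E : Finset (ZMod q)) :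
    bdry (u * d) (E.image fun x => u * x + v) = bdry d E := by
  have hinj : Function.Injective fun x : ZMod q => u * x + v := fun x y h => by
    simpa [hu] using h
  unfold bdry
  rw [← Finset.card_image_of_injective (E.filter fun x => x - d ∉ E) hinj]
  congr 1
  ext z
  simp only [Finset.mem_filter, Finset.mem_image]
  constructor
  · rintro ⟨⟨x, hx, rfl⟩, h⟩
    refine ⟨x, ⟨hx, fun h' => h ⟨_, h', by ring⟩⟩, rfl⟩
  · rintro ⟨x, ⟨hx, h⟩, rfl⟩
    refine ⟨⟨x, hx, rfl⟩, ?_⟩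
    rintro ⟨y, hy, hxy⟩
    apply h
    have : y = x - d := by
      apply mul_left_cancel₀ hu
      linear_combination hxy
    rwa [← this]

/-- A proper non-empty set with boundary at most `1` is an interval. -/
lemma exists_eq_interval {E : Finset (ZMod q)} (hne : E.Nonempty) (hlt : E.card < q)
    (h1 : bdry 1 E ≤ 1) : ∃ a : ZMod q, ∀ k < q, a + (k : ZMod q) ∈ E ↔ k < E.card := by
  obtain ⟨a, haE, ha⟩ : ∃ a ∈ E, a - 1 ∉ E := by
    by_contra! hcon
    obtain ⟨x, hx⟩ := hne
    have hall : ∀ k : ℕ, x - k ∈ E := by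
      intro k
      induction k with
      | zero => simpa using hx
      | succ k ih =>
        have := hcon _ ih
        rwa [show x - ((k + 1 : ℕ) : ZMod q) = x - k - 1 by push_cast; ring]
    have huniv : E = Finset.univ := by
      ext y
      simp only [Finset.mem_univ, iff_true]
      have := hall (x - y).val
      rwa [ZMod.natCast_zmod_val, sub_sub_cancel] at this
    rw [huniv, Finset.card_univ, ZMod.card] at hlt
    exact lt_irrefl _ hlt
  have huniq : ∀ x ∈ E, x ≠ a → x - 1 ∈ E := by
    intro x hx hxa
    by_contra hx1
    have h2 : ({a, x} : Finset (ZMod q)).card ≤ bdry 1 E := by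
      apply Finset.card_le_card
      intro y hy
      rcases Finset.mem_insert.1 hy with rfl | hy
      · simp [haE, ha]
      · rw [Finset.mem_singleton] at hy
        subst hy
        simp [hx, hx1]
    rw [Finset.card_pair (Ne.symm hxa)] at h2
    omega
  have hdown : ∀ k j : ℕ, j ≤ k → k < q → a + (k : ZMod q) ∈ E → a + (j : ZMod q) ∈ E := by
    intro k
    induction k with
    | zero => intro j hj _ h; obtain rfl : j = 0 := by omega
              exact h
    | succ k ih =>
      intro j hj hk h
      rcases Nat.lt_or_ge k j with h' | h'
      · obtain rfl : j = k + 1 := by omega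
        exact h
      · refine ih j h' (by omega) ?_
        have h3 : a + ((k + 1 : ℕ) : ZMod q) ≠ a := by
          intro h4
          have h5 : ((k + 1 : ℕ) : ZMod q) = 0 := by simpa using h4
          rw [ZMod.natCast_eq_zero_iff] at h5
          exact absurd (Nat.le_of_dvd (by omega) h5) (by omega)
        have := huniq _ h h3
        rwa [show a + ((k + 1 : ℕ) : ZMod q) - 1 = a + k by push_cast; ring] at this
  refine ⟨a, ?_⟩
  set F : Finset ℕ := (Finset.range q).filter fun k => a + (k : ZMod q) ∈ E with hF
  have hFE : F.card = E.card := by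
    refine Finset.card_bij (fun k _ => a + (k : ZMod q)) ?_ ?_ ?_
    · intro k hk; exact (Finset.mem_filter.1 hk).2
    · intro k hk j hj h
      have hk' := Finset.mem_range.1 (Finset.mem_filter.1 hk).1
      have hj' := Finset.mem_range.1 (Finset.mem_filter.1 hj).1
      have h6 : (k : ZMod q) = j := by simpa using h
      rw [ZMod.natCast_eq_natCast_iff'] at h6
      rwa [Nat.mod_eq_of_lt hk', Nat.mod_eq_of_lt hj'] at h6
    · intro x hx
      have hxx : a + ((x - a).val : ZMod q) = x := by rw [ZMod.natCast_zmod_val]; ring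
      refine ⟨(x - a).val, Finset.mem_filter.2 ⟨Finset.mem_range.2 (ZMod.val_lt _), ?_⟩, hxx⟩
      rwa [hxx]
  intro k hk
  constructor
  · intro h
    have : Finset.range (k + 1) ⊆ F := by
      intro j hj
      have hj' := Finset.mem_range.1 hj
      exact Finset.mem_filter.2 ⟨Finset.mem_range.2 (by omega), hdown k j (by omega) hk h⟩
    have := Finset.card_le_card this
    rw [Finset.card_range, hFE] at this
    omega
  · intro h
    by_contra hkE
    have : F ⊆ Finset.range k := by
      intro j hj
      have hj' := Finset.mem_filter.1 hj
      rw [Finset.mem_range] at hj' ⊢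
      by_contra hjk
      exact hkE (hdown j k (by omega) hj'.1 hj'.2)
    have := Finset.card_le_card this
    rw [Finset.card_range, hFE] at this
    omega

lemma le_bdry_of_bdry_one {E : Finset (ZMod q)} (hne : E.Nonempty) (hlt : E.card < q)
    (h1 : bdry 1 E ≤ 1) {k : ℕ} (hk : k < q) :
    min (min k (q - k)) (min E.card (q - E.card)) ≤ bdry (k : ZMod q) E := by
  obtain ⟨a, ha⟩ := exists_eq_interval hne hlt h1
  set n := E.card
  -- `a + j` lies in `E` and `a + j - k = a + (q + j - k)` does not for these `j`
  have hsub : (Finset.Ico (n + k - q) (min n k)).image (fun j : ℕ => a + (j : ZMod q)) ⊆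
      E.filter fun x => x - (k : ZMod q) ∉ E := by
    intro x hx
    obtain ⟨j, hj, rfl⟩ := Finset.mem_image.1 hx
    rw [Finset.mem_Ico] at hj
    refine Finset.mem_filter.2 ⟨(ha j (by omega)).2 (by omega), ?_⟩
    have h2 : a + (j : ZMod q) - k = a + ((q + j - k : ℕ) : ZMod q) := by
      rw [Nat.cast_sub (by omega)]
      push_cast
      simp
      ring
    rw [h2, ha _ (by omega)]
    omega
  have hcard := Finset.card_le_card hsub
  rw [Finset.card_image_of_injOn, Nat.card_Ico] at hcard
  · unfold bdry
    omega
  · intro i hi j hj h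
    have hi' := Finset.mem_Ico.1 (Finset.mem_coe.1 hi)
    have hj' := Finset.mem_Ico.1 (Finset.mem_coe.1 hj)
    have h6 : (i : ZMod q) = j := by simpa using h
    rw [ZMod.natCast_eq_natCast_iff'] at h6
    rwa [Nat.mod_eq_of_lt (by omega), Nat.mod_eq_of_lt (by omega)] at h6

/-- A set of size between `s` and `q - s` which is an arithmetic progression with difference `d`
has large boundary with respect to `c * d`, unless `c` is small. -/
lemma small_of_bdry {E : Finset (ZMod q)} {d c : ZMod q} {s : ℕ} (hd : d ≠ 0)
    (hs : s + 1 ≤ E.card) (hs' : E.card + (s + 1) ≤ q)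
    (h1 : bdry d E ≤ 1) (hc : bdry (c * d) E ≤ s) : c.val ≤ s ∨ q - s ≤ c.val := by
  set E' := E.image (fun x => d⁻¹ * x + 0)
  have hd' : d⁻¹ ≠ 0 := inv_ne_zero hd
  have hcard : E'.card = E.card := Finset.card_image_of_injective _ fun x y h => by
    simpa [hd] using h
  have h1' : bdry 1 E' ≤ 1 := by
    have := bdry_image hd' 0 d E
    rw [inv_mul_cancel₀ hd] at this
    exact this.trans_le h1
  have hc' : bdry c E' ≤ s := by
    have := bdry_image hd' 0 (c * d) E
    rw [show d⁻¹ * (c * d) = c by field_simp] at this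
    exact this.trans_le hc
  have := le_bdry_of_bdry_one (E := E') (Finset.card_pos.1 (by omega)) (by omega) h1'
    (ZMod.val_lt c)
  rw [ZMod.natCast_zmod_val] at this
  have := ZMod.val_lt c
  omega

lemma eq_of_val_le_one {c : ZMod q} (h : c.val ≤ 1 ∨ q - 1 ≤ c.val) :
    c = 0 ∨ c = 1 ∨ c = -1 := by
  have hc : ((c.val : ℕ) : ZMod q) = c := ZMod.natCast_zmod_val c
  have hlt := ZMod.val_lt c
  rcases h with h | h
  · interval_cases hv : c.val
    · left; simpa using hc.symm
    · right; left; simpa using hc.symm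
  · right; right
    have h2 : c.val = q - 1 := by omega
    rw [← hc, h2, Nat.cast_sub (by omega)]
    simp

lemma eq_of_val_le_two {c : ZMod q} (h : c.val ≤ 2 ∨ q - 2 ≤ c.val) (hq : 2 ≤ q) :
    c = 0 ∨ c = 1 ∨ c = -1 ∨ c = 2 ∨ c = -2 := by
  have hc : ((c.val : ℕ) : ZMod q) = c := ZMod.natCast_zmod_val c
  have hlt := ZMod.val_lt c
  by_cases h1 : c.val ≤ 1 ∨ q - 1 ≤ c.val
  · rcases eq_of_val_le_one h1 with h | h | h <;> simp [h]
  · rcases h with h | h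
    · have h2 : c.val = 2 := by omega
      rw [h2] at hc
      right; right; right; left; simpa using hc.symm
    · have h2 : c.val = q - 2 := by omega
      right; right; right; right
      rw [← hc, h2, Nat.cast_sub (by omega)]
      simp

/-- If `Y` and its translate by `d` lie in a set with at most one more element, then both `Y` and
this set are arithmetic progressions with difference `d`. -/
lemma bdry_le_one_of_subset {E Y : Finset (ZMod q)} {d : ZMod q} (hY : Y ⊆ E)
    (hYd : ∀ y ∈ Y, y + d ∈ E) (hc : E.card ≤ Y.card + 1) : bdry d E ≤ 1 ∧ bdry d Y ≤ 1 := by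
  set Z := Y.image (fun y => y + d) with hZ
  have hZc : Z.card = Y.card := Finset.card_image_of_injective _ (add_left_injective d)
  have hZE : Z ⊆ E := by
    intro z hz
    obtain ⟨y, hy, rfl⟩ := Finset.mem_image.1 hz
    exact hYd y hy
  constructor
  · have : (E.filter fun x => x - d ∉ E) ⊆ E \ Z := by
      intro x hx
      rw [Finset.mem_filter] at hx
      rw [Finset.mem_sdiff]
      refine ⟨hx.1, fun h => ?_⟩
      obtain ⟨y, hy, rfl⟩ := Finset.mem_image.1 h
      exact hx.2 (by simpa using hY hy)
    have := Finset.card_le_card this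
    rw [Finset.card_sdiff_of_subset hZE] at this
    unfold bdry
    omega
  · have : (Y.filter fun x => x - d ∉ Y) ⊆ Y \ Z := by
      intro x hx
      rw [Finset.mem_filter] at hx
      rw [Finset.mem_sdiff]
      refine ⟨hx.1, fun h => ?_⟩
      obtain ⟨y, hy, rfl⟩ := Finset.mem_image.1 h
      exact hx.2 (by simpa using hy)
    have h2 := Finset.card_le_card this
    have h3 : (Y \ Z).card = (Z \ Y).card := Finset.card_sdiff_comm hZc.symm
    have h4 : (Z \ Y).card ≤ (E \ Y).card :=
      Finset.card_le_card (Finset.sdiff_subset_sdiff hZE le_rfl)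
    rw [Finset.card_sdiff_of_subset hY] at h4
    unfold bdry
    omega

/-- Deleting one element from an arithmetic progression raises the boundary to at most `2`. -/
lemma bdry_le_two_of_subset {E Y : Finset (ZMod q)} {d : ZMod q} (hY : Y ⊆ E)
    (hc : E.card ≤ Y.card + 1) (hE : bdry d E ≤ 1) : bdry d Y ≤ 2 := by
  have : (Y.filter fun x => x - d ∉ Y) ⊆
      (E.filter fun x => x - d ∉ E) ∪ (E \ Y).image (fun y => y + d) := by
    intro x hx
    rw [Finset.mem_filter] at hx
    rw [Finset.mem_union, Finset.mem_filter, Finset.mem_image]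
    by_cases h : x - d ∈ E
    · exact Or.inr ⟨x - d, Finset.mem_sdiff.2 ⟨h, hx.2⟩, by ring⟩
    · exact Or.inl ⟨hY hx.1, h⟩
  have h2 := (Finset.card_le_card this).trans (Finset.card_union_le _ _)
  have h3 := Finset.card_image_le (s := E \ Y) (f := fun y => y + d)
  rw [Finset.card_sdiff_of_subset hY] at h3
  unfold bdry at *
  omega

end Boundary

variable {p q : ℕ} [Fact p.Prime] [Fact q.Prime] {χ : AddChar (ZMod p) (ZMod q)}

/-- Two elements of the semidirect product do not commute. -/
def NC (χ : AddChar (ZMod p) (ZMod q)) (g h : Elt p q) : Prop :=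
  g.1 + χ g.2 * h.1 ≠ h.1 + χ h.2 * g.1

lemma natCast_ne_zero_of_lt {n : ℕ} (hn : 0 < n) (hnq : n < q) : (n : ZMod q) ≠ 0 := by
  intro h
  rw [ZMod.natCast_eq_zero_iff] at h
  exact absurd (Nat.le_of_dvd hn h) (by omega)

/-- Adjoining a pair of non-commuting elements to a sequence yields at least two more products.
Otherwise the enlarged product set would be an arithmetic progression with two differences, which
forces the sequence and the pair to have twist zero; then the product set of the
sequence is an arithmetic progression nearly stable under multiplication by some `η` and by `η⁻¹`,
so that both are `± 2`, which is impossible for `q ≥ 7`. -/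
lemma card_Pr_add_pair (hp : Odd p) (hq : Odd q) (hq7 : 7 ≤ q) (hχ : Function.Injective χ)
    {R : Multiset (Elt p q)} {g h : Elt p q} (hgh : NC χ g h)
    (h3 : 3 ≤ (Pr χ R).card) (hle : (Pr χ R).card + 3 ≤ q) :
    (Pr χ R).card + 2 ≤ (Pr χ (R + {g, h})).card := by
  by_contra hcon
  set X := Pr χ R with hX
  set E := Pr χ (R + {g, h}) with hE
  have hEc : E.card ≤ X.card + 1 := by omega
  have hXE : X.card ≤ E.card := card_Pr_mono (Multiset.le_add_right _ _)
  set v := χ g.2 with hv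
  set w := χ h.2 with hw
  set W := χ (tw R) with hW
  have hv0 : v ≠ 0 := chi_ne_zero _
  have hw0 : w ≠ 0 := chi_ne_zero _
  have hW0 : W ≠ 0 := chi_ne_zero _
  set P := g.1 + v * h.1 with hP
  set Q := h.1 + w * g.1 with hQ
  have hd : P - Q ≠ 0 := sub_ne_zero.2 hgh
  have key : ∀ l : List (Elt p q), (l : Multiset (Elt p q)) = R + {g, h} → ev χ l ∈ E := fun l hl =>
    mem_Pr.2 ⟨l, hl, rfl⟩
  have pairs : ∀ x ∈ X, (P + v * w * x ∈ E ∧ Q + v * w * x ∈ E) ∧ (x + W * P ∈ E ∧ x + W * Q ∈ E) ∧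
      (g.1 + v * x + v * W * h.1 ∈ E ∧ h.1 + w * x + w * W * g.1 ∈ E) := by
    intro x hx
    obtain ⟨l, hl, rfl⟩ := mem_Pr.1 hx
    have hperm : ∀ a b c : List (Elt p q), a ++ b ++ c = [g, h] ∨ a ++ b ++ c = [h, g] →
        ((a ++ l ++ b ++ c : List (Elt p q)) : Multiset (Elt p q)) = R + {g, h} := by
      intro a b c hab
      have : ((a ++ b ++ c : List (Elt p q)) : Multiset (Elt p q)) = {g, h} := by
        rcases hab with h | h <;> rw [h]
        · rfl
        · exact Multiset.pair_comm _ _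
      rw [← this, ← hl]
      simp only [← Multiset.coe_add]
      abel
    refine ⟨⟨?_, ?_⟩, ⟨?_, ?_⟩, ⟨?_, ?_⟩⟩
    · convert key _ (hperm [g, h] [] [] (by simp)) using 1
      simp; ring
    · convert key _ (hperm [h, g] [] [] (by simp)) using 1
      simp; ring
    · convert key _ (hperm [] [g, h] [] (by simp)) using 1
      simp [ev_append, hl]; ring
    · convert key _ (hperm [] [h, g] [] (by simp)) using 1
      simp [ev_append, hl]; ring
    · convert key _ (hperm [g] [h] [] (by simp)) using 1
      simp [ev_append, hl]; ring
    · convert key _ (hperm [h] [g] [] (by simp)) using 1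
      simp [ev_append, hl]; ring
  have himg : ∀ u c : ZMod q, u ≠ 0 → (X.image fun x => u * x + c).card = X.card := fun u c hu =>
    Finset.card_image_of_injective _ fun x y h => by simpa [hu] using h
  -- `E` is an arithmetic progression with the differences `P - Q` and `W * (P - Q)`
  obtain ⟨hE1, hX1⟩ : bdry (P - Q) E ≤ 1 ∧ bdry (P - Q) (X.image fun x => v * w * x + Q) ≤ 1 := by
    apply bdry_le_one_of_subset
    · intro y hy
      obtain ⟨x, hx, rfl⟩ := Finset.mem_image.1 hy
      rw [add_comm]; exact (pairs x hx).1.2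
    · intro y hy
      obtain ⟨x, hx, rfl⟩ := Finset.mem_image.1 hy
      convert (pairs x hx).1.1 using 1; ring
    · rw [himg _ _ (mul_ne_zero hv0 hw0)]; exact hEc
  obtain ⟨hE2, hX2⟩ : bdry (W * (P - Q)) E ≤ 1 ∧
      bdry (W * (P - Q)) (X.image fun x => 1 * x + W * Q) ≤ 1 := by
    apply bdry_le_one_of_subset
    · intro y hy
      obtain ⟨x, hx, rfl⟩ := Finset.mem_image.1 hy
      rw [one_mul]; exact (pairs x hx).2.1.2
    · intro y hy
      obtain ⟨x, hx, rfl⟩ := Finset.mem_image.1 hy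
      convert (pairs x hx).2.1.1 using 1; ring
    · rw [himg _ _ one_ne_zero]; exact hEc
  have hW1 : W = 1 := by
    rcases eq_of_val_le_one (small_of_bdry hd (by omega) (by omega) hE1 hE2) with h | h | h
    · exact absurd h hW0
    · exact h
    · exact absurd h (chi_ne_neg_one hp hq hχ _)
  rw [hW1, one_mul (P - Q)] at hX2
  have hXd : bdry (P - Q) X ≤ 1 := by
    have := bdry_image one_ne_zero (1 * Q) (P - Q) X
    rw [one_mul (P - Q)] at this
    exact this.symm.trans_le hX2
  have hvw : v * w = 1 := by
    have h4 := bdry_image (mul_ne_zero hv0 hw0) Q ((v * w)⁻¹ * (P - Q)) X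
    rw [mul_inv_cancel_left₀ (mul_ne_zero hv0 hw0)] at h4
    have h5 : bdry ((v * w)⁻¹ * (P - Q)) X ≤ 1 := by omega
    have hinv : (v * w)⁻¹ = χ (-(g.2 + h.2)) := by
      rw [hv, hw, ← AddChar.map_add_eq_mul]
      exact inv_eq_of_mul_eq_one_right (chi_mul_neg _)
    rcases eq_of_val_le_one (small_of_bdry hd (by omega) (by omega) hXd h5) with h | h | h
    · exact absurd h (inv_ne_zero (mul_ne_zero hv0 hw0))
    · exact inv_eq_one.1 h
    · rw [hinv] at h
      exact absurd h (chi_ne_neg_one hp hq hχ _)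
  have hv1 : v ≠ 1 := by
    intro h
    have hw1 : w = 1 := by simpa [h] using hvw
    apply hgh
    rw [← hv, ← hw, h, hw1]; ring
  -- `v` and `v⁻¹ = w` nearly stabilise `X`
  have hstab : ∀ u c : ZMod q, u ≠ 0 → (∀ x ∈ X, u * x + c ∈ E) →
      bdry (u⁻¹ * (P - Q)) X ≤ 2 := by
    intro u c hu hs
    have h4 := bdry_image hu c (u⁻¹ * (P - Q)) X
    rw [mul_inv_cancel_left₀ hu] at h4
    rw [← h4]
    refine bdry_le_two_of_subset ?_ ?_ hE1
    · intro y hy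
      obtain ⟨x, hx, rfl⟩ := Finset.mem_image.1 hy
      exact hs x hx
    · rw [himg _ _ hu]; exact hEc
  have hA := hstab v (g.1 + v * W * h.1) hv0 fun x hx => by
    convert (pairs x hx).2.2.1 using 1; ring
  have hB := hstab w (h.1 + w * W * g.1) hw0 fun x hx => by
    convert (pairs x hx).2.2.2 using 1; ring
  have hvi : v⁻¹ = w := inv_eq_of_mul_eq_one_right hvw
  have hwi : w⁻¹ = v := by rw [← hvi, inv_inv]
  rw [hvi] at hA
  rw [hwi] at hB
  have hcases : ∀ i : ZMod p, bdry (χ i * (P - Q)) X ≤ 2 → χ i ≠ 1 → χ i = 2 ∨ χ i = -2 := by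
    intro i hi hi1
    rcases eq_of_val_le_two (small_of_bdry hd (by omega) (by omega) hXd hi) (by omega) with
      h | h | h | h | h
    · exact absurd h (chi_ne_zero _)
    · exact absurd h hi1
    · exact absurd h (chi_ne_neg_one hp hq hχ _)
    · exact Or.inl h
    · exact Or.inr h
  have h3' : (3 : ZMod q) ≠ 0 := by
    exact_mod_cast natCast_ne_zero_of_lt (q := q) (n := 3) (by norm_num) (by omega)
  have h5' : (5 : ZMod q) ≠ 0 := by
    exact_mod_cast natCast_ne_zero_of_lt (q := q) (n := 5) (by norm_num) (by omega)
  have hw1 : w ≠ 1 := by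
    rintro h
    rw [h, mul_one] at hvw
    exact hv1 hvw
  rcases hcases _ hA hw1 with h6 | h6 <;> rcases hcases _ hB hv1 with h7 | h7 <;>
    rw [← hv] at h7 <;> rw [← hw] at h6 <;> rw [h6, h7] at hvw
  · exact h3' (by linear_combination hvw)
  · exact h5' (by linear_combination -hvw)
  · exact h5' (by linear_combination -hvw)
  · exact h3' (by linear_combination hvw)

end PairGrowth

/-! ### Triples of pairwise non-commuting terms -/

section TripleGrowth

/-- Six cyclically arranged points of which neighbours differ take at least four values, unless the
points of two opposite pairs coincide, or the two neighbours of a point coincide and so do those of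
the opposite point. -/
lemma four_le_card_of_hexagon {α : Type*} [DecidableEq α] {s : Finset α} {A B C D E F : α}
    (hA : A ∈ s) (hB : B ∈ s) (hC : C ∈ s) (hD : D ∈ s) (hE : E ∈ s) (hF : F ∈ s)
    (h1 : A ≠ B) (h2 : B ≠ C) (h3 : C ≠ D) (h4 : D ≠ E) (h5 : E ≠ F) (h6 : F ≠ A)
    (h7 : A = C → D ≠ F) (h8 : C = E → B ≠ F) (h9 : A = E → B ≠ D)
    (h10 : A = D → C ≠ F) (h11 : B = E → C ≠ F) : 4 ≤ s.card := by
  by_contra hcon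
  have key : ∀ x ∈ s, ∀ y ∈ s, ∀ z ∈ s, ∀ t ∈ s,
      x = y ∨ x = z ∨ x = t ∨ y = z ∨ y = t ∨ z = t := by
    intro x hx y hy z hz t ht
    by_contra! h
    obtain ⟨hxy, hxz, hxt, hyz, hyt, hzt⟩ := h
    have : ({x, y, z, t} : Finset α).card = 4 := by
      rw [Finset.card_insert_of_notMem (by simp [hxy, hxz, hxt]),
        Finset.card_insert_of_notMem (by simp [hyz, hyt]), Finset.card_pair hzt]
    apply hcon
    rw [← this]
    apply Finset.card_le_card
    intro u hu
    simp only [Finset.mem_insert, Finset.mem_singleton] at hu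
    rcases hu with rfl | rfl | rfl | rfl <;> assumption
  have k1 := key A hA B hB C hC D hD
  have k2 := key A hA B hB C hC E hE
  have k3 := key A hA B hB C hC F hF
  have k4 := key A hA B hB D hD E hE
  have k5 := key A hA B hB D hD F hF
  have k6 := key A hA B hB E hE F hF
  have k7 := key A hA C hC D hD E hE
  have k8 := key A hA C hC D hD F hF
  have k9 := key A hA C hC E hE F hF
  have k10 := key A hA D hD E hE F hF
  have k11 := key B hB C hC D hD E hE
  have k12 := key B hB C hC D hD F hF
  have k13 := key B hB C hC E hE F hF
  have k14 := key B hB D hD E hE F hF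
  have k15 := key C hC D hD E hE F hF
  clear hcon key hA hB hC hD hE hF
  grind

variable {p q : ℕ} [Fact p.Prime] [Fact q.Prime] {χ : AddChar (ZMod p) (ZMod q)}

lemma perms_mem_Pr (a b c : Elt p q) :
    a.1 + χ a.2 * (b.1 + χ b.2 * c.1) ∈ Pr χ {a, b, c} ∧
    b.1 + χ b.2 * (a.1 + χ a.2 * c.1) ∈ Pr χ {a, b, c} ∧
    b.1 + χ b.2 * (c.1 + χ c.2 * a.1) ∈ Pr χ {a, b, c} ∧
    c.1 + χ c.2 * (b.1 + χ b.2 * a.1) ∈ Pr χ {a, b, c} ∧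
    c.1 + χ c.2 * (a.1 + χ a.2 * b.1) ∈ Pr χ {a, b, c} ∧
    a.1 + χ a.2 * (c.1 + χ c.2 * b.1) ∈ Pr χ {a, b, c} := by
  have key : ∀ x y z : Elt p q, ({x, y, z} : Multiset (Elt p q)) = {a, b, c} →
      x.1 + χ x.2 * (y.1 + χ y.2 * z.1) ∈ Pr χ {a, b, c} := fun x y z h =>
    mem_Pr.2 ⟨[x, y, z], h, by simp⟩
  have s1 : ∀ x y z : Elt p q, ({x, y, z} : Multiset (Elt p q)) = {y, x, z} := fun x y z =>
    Multiset.cons_swap _ _ _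
  have s2 : ∀ x y z : Elt p q, ({x, y, z} : Multiset (Elt p q)) = {x, z, y} := fun x y z => by
    change x ::ₘ {y, z} = x ::ₘ {z, y}
    rw [Multiset.pair_comm]
  refine ⟨key _ _ _ rfl, key _ _ _ (s1 _ _ _), key _ _ _ ?_, key _ _ _ ?_, key _ _ _ ?_,
    key _ _ _ (s2 _ _ _)⟩
  · rw [s2, s1]
  · rw [s1, s2, s1]
  · rw [s1, s2]

/-- Three pairwise non-commuting elements of non-zero twist have at least four products. Around the
hexagon of the six orderings neighbours differ by a swap of two adjacent terms, hence have distinct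
products; the coincidences needed for only three values force `χ i = 1` or `χ i = -1` for the twist
`i` of one of the terms. -/
lemma four_le_card_triple (hp : Odd p) (hq : Odd q) (hχ : Function.Injective χ) {a b c : Elt p q}
    (ha : a.2 ≠ 0) (hb : b.2 ≠ 0) (hc : c.2 ≠ 0) (hab : NC χ a b) (hbc : NC χ b c)
    (hac : NC χ a c) : 4 ≤ (Pr χ {a, b, c}).card := by
  obtain ⟨m1, m2, m3, m4, m5, m6⟩ := perms_mem_Pr (χ := χ) a b c
  have na0 : χ a.2 ≠ 0 := chi_ne_zero _
  have nb0 : χ b.2 ≠ 0 := chi_ne_zero _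
  have nc0 : χ c.2 ≠ 0 := chi_ne_zero _
  have na1 : χ a.2 - 1 ≠ 0 := sub_ne_zero.2 fun h => ha ((chi_eq_one_iff hχ).1 h)
  have nb1 : χ b.2 - 1 ≠ 0 := sub_ne_zero.2 fun h => hb ((chi_eq_one_iff hχ).1 h)
  have nc1 : χ c.2 - 1 ≠ 0 := sub_ne_zero.2 fun h => hc ((chi_eq_one_iff hχ).1 h)
  have na2 : χ a.2 + 1 ≠ 0 := fun h =>
    chi_ne_neg_one hp hq hχ a.2 (eq_neg_of_add_eq_zero_left h)
  have nb2 : χ b.2 + 1 ≠ 0 := fun h =>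
    chi_ne_neg_one hp hq hχ b.2 (eq_neg_of_add_eq_zero_left h)
  have dab := sub_ne_zero.2 hab
  have dbc := sub_ne_zero.2 hbc
  have dac := sub_ne_zero.2 hac
  have prod2 : ∀ {x y : ZMod q}, x ≠ 0 → y ≠ 0 → x * y ≠ 0 := fun hx hy => mul_ne_zero hx hy
  refine four_le_card_of_hexagon m1 m2 m3 m4 m5 m6 ?_ ?_ ?_ ?_ ?_ ?_ ?_ ?_ ?_ ?_ ?_
  · intro h; exact dab (by linear_combination h)
  · intro h; exact prod2 nb0 dac (by linear_combination h)
  · intro h; exact dbc (by linear_combination h)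
  · intro h; exact prod2 nc0 dab (by linear_combination -h)
  · intro h; exact dac (by linear_combination -h)
  · intro h; exact prod2 na0 dbc (by linear_combination -h)
  · intro h h'; exact prod2 na1 dbc (by linear_combination h + h')
  · intro h h'; exact prod2 nb1 dac (by linear_combination h' - h)
  · intro h h'; exact prod2 nc1 dab (by linear_combination h' - h)
  · intro h h'; exact prod2 na2 dbc (by linear_combination h + h')
  · intro h h'; exact prod2 nb2 dac (by linear_combination h - h')

/-- Three elements different from the identity which do not all commute have at least three
products. -/
lemma three_le_card_triple (hp : Odd p) (hq : Odd q) (hχ : Function.Injective χ) {a b e : Elt p q}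
    (hab : NC χ a b) (he : e ≠ 0) : 3 ≤ (Pr χ {a, b, e}).card := by
  obtain ⟨m1, m2, m3, m4, m5, m6⟩ := perms_mem_Pr (χ := χ) a b e
  have na0 : χ a.2 ≠ 0 := chi_ne_zero _
  have ne0 : χ e.2 ≠ 0 := chi_ne_zero _
  have dab := sub_ne_zero.2 hab
  have nev : χ e.2 + 1 ≠ 0 := fun h =>
    chi_ne_neg_one hp hq hχ e.2 (eq_neg_of_add_eq_zero_left h)
  have n2 : (2 : ZMod q) ≠ 0 := by
    intro h
    exact chi_ne_neg_one hp hq hχ 0 (by rw [AddChar.map_zero_eq_one]; linear_combination h)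
  by_contra hcon
  set X := e.1 + χ e.2 * (a.1 + χ a.2 * b.1) with hX
  set Y := e.1 + χ e.2 * (b.1 + χ b.2 * a.1) with hY
  have hXY : X ≠ Y := fun h => mul_ne_zero ne0 dab (by rw [hX, hY] at h; linear_combination h)
  have hmem : ∀ z ∈ Pr χ {a, b, e}, z = X ∨ z = Y := by
    intro z hz
    by_contra! hzz
    have h3 : ({z, X, Y} : Finset (ZMod q)).card = 3 := by
      rw [Finset.card_insert_of_notMem (by simp [hzz]), Finset.card_pair hXY]
    have : ({z, X, Y} : Finset (ZMod q)) ⊆ Pr χ {a, b, e} := by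
      intro u hu
      simp only [Finset.mem_insert, Finset.mem_singleton] at hu
      rcases hu with rfl | rfl | rfl <;> assumption
    have := Finset.card_le_card this
    omega
  have hv1 : χ e.2 = 1 := by
    rcases hmem _ m1 with h1 | h1 <;> rcases hmem _ m2 with h2 | h2
    · exact absurd (by linear_combination h1 - h2) dab
    · exact sub_eq_zero.1 ((mul_eq_zero.1
        (by linear_combination h2 - h1 : (χ e.2 - 1) *
          (a.1 + χ a.2 * b.1 - (b.1 + χ b.2 * a.1)) = 0)).resolve_right dab)
    · exact absurd (mul_eq_zero.1
        (by linear_combination h1 - h2 : (χ e.2 + 1) *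
          (a.1 + χ a.2 * b.1 - (b.1 + χ b.2 * a.1)) = 0))
        (by simp only [nev, dab, or_self, not_false_eq_true])
    · exact absurd (by linear_combination h1 - h2) dab
  have he2 : e.2 = 0 := (chi_eq_one_iff hχ).1 hv1
  have he1 : e.1 ≠ 0 := fun h => he (Prod.ext h he2)
  have hw1 : χ a.2 * χ b.2 = 1 := by
    rcases hmem _ m1 with h1 | h1
    · rw [hX, hv1] at h1
      exact sub_eq_zero.1 ((mul_eq_zero.1
        (by linear_combination h1 : (χ a.2 * χ b.2 - 1) * e.1 = 0)).resolve_right he1)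
    · rcases hmem _ m2 with h2 | h2
      · rw [hY, hv1] at h1
        rw [hX, hv1] at h2
        exact absurd (mul_eq_zero.1 (by linear_combination h1 - h2 : (2 : ZMod q) *
          (a.1 + χ a.2 * b.1 - (b.1 + χ b.2 * a.1)) = 0))
          (by simp only [n2, dab, or_self, not_false_eq_true])
      · rw [hY, hv1] at h2
        exact sub_eq_zero.1 ((mul_eq_zero.1
          (by linear_combination h2 : (χ a.2 * χ b.2 - 1) * e.1 = 0)).resolve_right he1)
  have ha1 : χ a.2 ≠ 1 := by
    intro h
    apply hab
    rw [h, one_mul] at hw1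
    rw [h, hw1]; ring
  have hb1 : χ b.2 ≠ 1 := by
    intro h
    rw [h, mul_one] at hw1
    exact ha1 hw1
  have h3 : b.1 + χ b.2 * (e.1 + χ e.2 * a.1) = X := by
    refine (hmem _ m3).resolve_right fun h => ?_
    rw [hY, hv1] at h
    exact mul_ne_zero (sub_ne_zero.2 hb1) he1 (by linear_combination h)
  have h6 : a.1 + χ a.2 * (e.1 + χ e.2 * b.1) = Y := by
    refine (hmem _ m6).resolve_left fun h => ?_
    rw [hX, hv1] at h
    exact mul_ne_zero (sub_ne_zero.2 ha1) he1 (by linear_combination h)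
  rw [hX, hv1] at h3
  rw [hY, hv1] at h6
  have h7 : (χ a.2 + χ b.2 - 2) * e.1 = 0 := by linear_combination h3 + h6
  have h8 := (mul_eq_zero.1 h7).resolve_right he1
  have h9 : (χ a.2 - 1) * (χ a.2 - 1) = 0 := by linear_combination χ a.2 * h8 - hw1
  exact mul_ne_zero (sub_ne_zero.2 ha1) (sub_ne_zero.2 ha1) h9

end TripleGrowth

/-! ### Colours, rainbow matchings and full product sets -/

section Colours

section Matching

variable {α β : Type*} [DecidableEq β] (κ : α → β)

/-- The sequence formed by the entries of a list of pairs. -/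
def pairSum (L : List (α × α)) : Multiset α := (L.map fun x => ({x.1, x.2} : Multiset α)).sum

@[simp] lemma pairSum_nil : pairSum ([] : List (α × α)) = 0 := rfl

@[simp] lemma pairSum_cons (x : α × α) (L : List (α × α)) :
    pairSum (x :: L) = {x.1, x.2} + pairSum L := by
  simp [pairSum]

lemma card_eq_countP_add (M : Multiset α) (b : β) :
    M.card = M.countP (fun x => κ x = b) + M.countP (fun x => κ x ≠ b) :=
  Multiset.card_eq_countP_add_countP _ _

lemma countP_three_le (M : Multiset α) {a b c : β} (hab : a ≠ b) (hac : a ≠ c) (hbc : b ≠ c) :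
    M.countP (fun x => κ x = a) + M.countP (fun x => κ x = b) + M.countP (fun x => κ x = c) ≤
      M.card := by
  induction M using Multiset.induction_on with
  | empty => simp
  | cons x M ih =>
    simp only [Multiset.countP_cons, Multiset.card_cons]
    split_ifs <;> first | omega | (exfalso; grind)

lemma countP_four_le (M : Multiset α) {a b c d : β} (hab : a ≠ b) (hac : a ≠ c) (had : a ≠ d)
    (hbc : b ≠ c) (hbd : b ≠ d) (hcd : c ≠ d) :
    M.countP (fun x => κ x = a) + M.countP (fun x => κ x = b) + M.countP (fun x => κ x = c) +
      M.countP (fun x => κ x = d) ≤ M.card := by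
  induction M using Multiset.induction_on with
  | empty => simp
  | cons x M ih =>
    simp only [Multiset.countP_cons, Multiset.card_cons]
    split_ifs <;> first | omega | (exfalso; grind)

/-- A coloured multiset contains `N` disjoint bichromatic pairs, as soon as every colour is avoided
by `N` of its elements. Such pairs can be removed one at a time, always from the two most frequent
colours. -/
lemma exists_pairs (N : ℕ) : ∀ (M : Multiset α), 2 * N ≤ M.card →
    (∀ b, N ≤ M.countP (fun x => κ x ≠ b)) →
    ∃ L : List (α × α), L.length = N ∧ (∀ x ∈ L, κ x.1 ≠ κ x.2) ∧ pairSum L ≤ M := by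
  induction N with
  | zero => intro M _ _; exact ⟨[], rfl, by simp, by simp⟩
  | succ N ih =>
    intro M hM hcol
    have hM0 : M ≠ 0 := by rintro rfl; simp at hM
    obtain ⟨x, hx, hxmax⟩ := Multiset.exists_max_image
      (fun y => M.countP (fun z => κ z = κ y)) hM0
    have hM2 : M.filter (fun z => κ z ≠ κ x) ≠ 0 := by
      rw [← Multiset.card_pos, ← Multiset.countP_eq_card_filter]
      exact lt_of_lt_of_le (Nat.succ_pos N) (hcol (κ x))
    obtain ⟨y, hy, hymax⟩ := Multiset.exists_max_image
      (fun y => M.countP (fun z => κ z = κ y)) hM2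
    rw [Multiset.mem_filter] at hy
    have hyx : y ≠ x := fun h => hy.2 (by rw [h])
    obtain ⟨M₁, rfl⟩ := Multiset.exists_cons_of_mem hx
    obtain ⟨M', rfl⟩ := Multiset.exists_cons_of_mem
      ((Multiset.mem_cons.1 hy.1).resolve_left hyx)
    obtain ⟨L, hL1, hL2, hL3⟩ := ih M' (by simp at hM; omega) (by
      intro b
      by_contra hlt
      have h1 := hcol b
      have h2 := card_eq_countP_add κ (x ::ₘ y ::ₘ M') b
      have hbx : κ x ≠ b := by
        rintro rfl
        rw [Multiset.countP_cons_of_neg _ (by simp), Multiset.countP_cons] at h1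
        split_ifs at h1 <;> omega
      have hby : κ y ≠ b := by
        rintro rfl
        rw [Multiset.countP_cons, Multiset.countP_cons_of_neg _ (by simp)] at h1
        split_ifs at h1; omega
      have h3 : (x ::ₘ y ::ₘ M').countP (fun z => κ z ≠ b) = N + 1 := by
        refine le_antisymm ?_ h1
        rw [Multiset.countP_cons, Multiset.countP_cons]
        split_ifs
        omega
      have h4 : 0 < (x ::ₘ y ::ₘ M').countP (fun z => κ z = b) := by omega
      obtain ⟨z, hz, hzb⟩ := Multiset.countP_pos.1 h4
      have h5 := hxmax y hy.1
      have h6 := hymax z (Multiset.mem_filter.2 ⟨hz, by rw [hzb]; exact hbx.symm⟩)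
      have h7 := countP_three_le κ (x ::ₘ y ::ₘ M') hy.2.symm hbx hby
      simp only [hzb] at h6
      omega)
    refine ⟨(x, y) :: L, by simp [hL1], ?_, ?_⟩
    · intro z hz
      rcases List.mem_cons.1 hz with rfl | hz
      · exact hy.2.symm
      · exact hL2 z hz
    · rw [pairSum_cons]
      change x ::ₘ {y} + pairSum L ≤ _
      rw [Multiset.cons_add, Multiset.singleton_add]
      exact Multiset.cons_le_cons _ (Multiset.cons_le_cons _ hL3)

/-- If every colour occurs less than half of the time, then removing one element from each of the
three most frequent colours leaves a multiset in which no colour is used more than half of the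
time. This fails for four elements of different colours. -/
lemma exists_rainbow_triple [Nonempty β] (M : Multiset α) (h4 : M.card ≠ 4)
    (hcol : ∀ b, 2 * M.countP (fun x => κ x = b) + 1 ≤ M.card) :
    ∃ x y z, ∃ M', M = {x, y, z} + M' ∧ κ x ≠ κ y ∧ κ y ≠ κ z ∧ κ x ≠ κ z ∧
      ∀ b, 2 * M'.countP (fun x => κ x = b) ≤ M'.card := by
  have hM0 : M ≠ 0 := by
    rintro rfl
    simpa using hcol (Classical.arbitrary β)
  obtain ⟨x, hx, hxmax⟩ := Multiset.exists_max_image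
    (fun y => M.countP (fun z => κ z = κ y)) hM0
  have hM2 : M.filter (fun z => κ z ≠ κ x) ≠ 0 := by
    rw [← Multiset.card_pos, ← Multiset.countP_eq_card_filter]
    have := hcol (κ x)
    have := card_eq_countP_add κ M (κ x)
    omega
  obtain ⟨y, hy, hymax⟩ := Multiset.exists_max_image
    (fun y => M.countP (fun z => κ z = κ y)) hM2
  rw [Multiset.mem_filter] at hy
  have hM3 : (M.filter (fun z => κ z ≠ κ x)).filter (fun z => κ z ≠ κ y) ≠ 0 := by
    rw [← Multiset.card_pos, ← Multiset.countP_eq_card_filter]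
    have h1 := hcol (κ x)
    have h2 := card_eq_countP_add κ M (κ x)
    have h3 := card_eq_countP_add κ (M.filter (fun z => κ z ≠ κ x)) (κ y)
    have h5 := Multiset.countP_le_of_le (fun z => κ z = κ y)
      (Multiset.filter_le (fun z => κ z ≠ κ x) M)
    have h6 := hxmax y hy.1
    rw [← Multiset.countP_eq_card_filter] at h3
    omega
  obtain ⟨z, hz, hzmax⟩ := Multiset.exists_max_image
    (fun y => M.countP (fun z => κ z = κ y)) hM3
  rw [Multiset.mem_filter, Multiset.mem_filter] at hz
  have hyx : y ≠ x := fun h => hy.2 (by rw [h])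
  have hzx : z ≠ x := fun h => hz.1.2 (by rw [h])
  have hzy : z ≠ y := fun h => hz.2 (by rw [h])
  have hyz := hymax z (Multiset.mem_filter.2 hz.1)
  have hxy := hxmax y hy.1
  obtain ⟨M₁, rfl⟩ := Multiset.exists_cons_of_mem hx
  obtain ⟨M₂, rfl⟩ := Multiset.exists_cons_of_mem
    ((Multiset.mem_cons.1 hy.1).resolve_left hyx)
  obtain ⟨M', rfl⟩ := Multiset.exists_cons_of_mem
    ((Multiset.mem_cons.1 ((Multiset.mem_cons.1 hz.1.1).resolve_left hzx)).resolve_left hzy)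
  refine ⟨x, y, z, M', by simp [Multiset.insert_eq_cons], hy.2.symm, hz.2.symm,
    hz.1.2.symm, fun b => ?_⟩
  have hb := hcol b
  by_cases hbM : ∃ t ∈ M', κ t = b
  · obtain ⟨t, ht, rfl⟩ := hbM
    simp only [Multiset.countP_cons, Multiset.card_cons] at hb h4
    by_cases h1 : κ x = κ t
    · simp only [h1, if_true] at hb; omega
    by_cases h2 : κ y = κ t
    · simp only [h2, if_true] at hb; omega
    by_cases h3 : κ z = κ t
    · simp only [h3, if_true] at hb; omega
    have h5 := hzmax t (Multiset.mem_filter.2 ⟨Multiset.mem_filter.2 ⟨by simp [ht], Ne.symm h1⟩,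
      Ne.symm h2⟩)
    have h6 := countP_four_le κ (x ::ₘ y ::ₘ z ::ₘ M') hy.2.symm hz.1.2.symm h1 hz.2.symm h2 h3
    have h7 : (x ::ₘ y ::ₘ z ::ₘ M').countP (fun u => κ u = κ t) =
        M'.countP (fun u => κ u = κ t) := by
      simp only [Multiset.countP_cons, h1, h2, h3, if_false, add_zero]
    simp only [Multiset.card_cons] at h6
    omega
  · have : M'.countP (fun x => κ x = b) = 0 := by
      rw [Multiset.countP_eq_zero]
      intro t ht htb
      exact hbM ⟨t, ht, htb⟩
    omega

end Matching

variable {p q : ℕ} [Fact p.Prime] [Fact q.Prime] {χ : AddChar (ZMod p) (ZMod q)}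

/-- The colour of an element of the semidirect product: the fixed point of the affine map
`x ↦ g.1 + χ g.2 * x`, with the value `none` if the twist vanishes and this map is a translation.
Elements different from the identity commute if and only if their colours agree. -/
def color (χ : AddChar (ZMod p) (ZMod q)) (g : Elt p q) : Option (ZMod q) :=
  if g.2 = 0 then none else some (g.1 / (1 - χ g.2))

lemma color_eq_none_iff {g : Elt p q} : color χ g = none ↔ g.2 = 0 := by
  unfold color; split_ifs with h <;> simp [h]

lemma color_eq_some_iff (hχ : Function.Injective χ) {g : Elt p q} {z : ZMod q} :
    color χ g = some z ↔ g.2 ≠ 0 ∧ g.1 = z * (1 - χ g.2) := by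
  unfold color
  split_ifs with h
  · simp [h]
  · have h1 : 1 - χ g.2 ≠ 0 := sub_ne_zero.2 fun h' => h ((chi_eq_one_iff hχ).1 h'.symm)
    simp [h, div_eq_iff h1]

lemma NC_of_color_ne (hχ : Function.Injective χ) {g h : Elt p q} (hg : g ≠ 0) (hh : h ≠ 0)
    (hne : color χ g ≠ color χ h) : NC χ g h := by
  intro hcomm
  apply hne
  by_cases hg2 : g.2 = 0
  · have hg1 : g.1 ≠ 0 := fun h' => hg (Prod.ext h' hg2)
    rw [color_eq_none_iff.2 hg2, eq_comm, color_eq_none_iff]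
    rw [hg2, AddChar.map_zero_eq_one] at hcomm
    have h1 : (1 - χ h.2) * g.1 = 0 := by linear_combination hcomm
    exact (chi_eq_one_iff hχ).1 (sub_eq_zero.1 ((mul_eq_zero.1 h1).resolve_right hg1)).symm
  by_cases hh2 : h.2 = 0
  · exfalso
    have hh1 : h.1 ≠ 0 := fun h' => hh (Prod.ext h' hh2)
    rw [hh2, AddChar.map_zero_eq_one] at hcomm
    have h1 : (1 - χ g.2) * h.1 = 0 := by linear_combination -hcomm
    exact hg2 ((chi_eq_one_iff hχ).1 (sub_eq_zero.1 ((mul_eq_zero.1 h1).resolve_right hh1)).symm)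
  have n1 : 1 - χ g.2 ≠ 0 := sub_ne_zero.2 fun h' => hg2 ((chi_eq_one_iff hχ).1 h'.symm)
  have n2 : 1 - χ h.2 ≠ 0 := sub_ne_zero.2 fun h' => hh2 ((chi_eq_one_iff hχ).1 h'.symm)
  simp only [color, hg2, hh2, if_false]
  congr 1
  rw [div_eq_div_iff n1 n2]
  linear_combination hcomm

/-- Each non-commuting pair adds two products, until at most two values are missing. -/
lemma card_Pr_add_pairSum (hp : Odd p) (hq : Odd q) (hq7 : 7 ≤ q) (hχ : Function.Injective χ)
    {L : List (Elt p q × Elt p q)} (hL : ∀ x ∈ L, NC χ x.1 x.2) {R : Multiset (Elt p q)}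
    (h3 : 3 ≤ (Pr χ R).card) :
    min (q - 2) ((Pr χ R).card + 2 * L.length) ≤ (Pr χ (R + pairSum L)).card := by
  induction L generalizing R with
  | nil => simp
  | cons x L ih =>
    rw [pairSum_cons, ← add_assoc, List.length_cons]
    have h1 : (Pr χ R).card ≤ (Pr χ (R + {x.1, x.2})).card :=
      card_Pr_mono (Multiset.le_add_right _ _)
    have h2 := ih (fun y hy => hL y (List.mem_cons_of_mem _ hy)) (h3.trans h1)
    by_cases h4 : (Pr χ R).card + 3 ≤ q
    · have := card_Pr_add_pair hp hq hq7 hχ (hL x List.mem_cons_self) h3 h4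
      omega
    · omega

lemma two_le_card_Pr_pair {a b : Elt p q} (h : NC χ a b) : 2 ≤ (Pr χ {a, b}).card := by
  rw [← Finset.card_pair h]
  apply Finset.card_le_card
  intro u hu
  simp only [Finset.mem_insert, Finset.mem_singleton] at hu
  rcases hu with rfl | rfl
  · exact mem_Pr.2 ⟨[a, b], rfl, by simp⟩
  · exact mem_Pr.2 ⟨[b, a], Multiset.pair_comm _ _, by simp⟩

/-- Disjoint non-commuting pairs with at least `q + 1` entries in total attain all products. The
entries of one pair are distributed to two others: one of the triples starts with three products,
and the other one supplies the last two by Cauchy–Davenport. -/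
lemma Pr_univ_of_pairs (hp : Odd p) (hq : Odd q) (hq7 : 7 ≤ q) (hχ : Function.Injective χ)
    {L : List (Elt p q × Elt p q)} (hL : ∀ x ∈ L, NC χ x.1 x.2 ∧ x.1 ≠ 0 ∧ x.2 ≠ 0)
    (hlen : q + 1 ≤ 2 * L.length) : Pr χ (pairSum L) = Finset.univ := by
  match L, hlen, hL with
  | [], hlen, _ => simp at hlen
  | [x], hlen, _ => simp at hlen; omega
  | [x, y], hlen, _ => simp at hlen; omega
  | x :: y :: z :: L, hlen, hL =>
    simp only [List.length_cons] at hlen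
    have e1 := three_le_card_triple hp hq hχ (hL x (by simp)).1 (hL z (by simp)).2.1
    have e2 := three_le_card_triple hp hq hχ (hL y (by simp)).1 (hL z (by simp)).2.2
    have e3 := card_Pr_add_pairSum hp hq hq7 hχ (L := L) (fun w hw => (hL w (by simp [hw])).1) e1
    have e4 := card_Pr_add (χ := χ) ({x.1, x.2, z.1} + pairSum L) {y.1, y.2, z.2}
    have e5 : ({x.1, x.2, z.1} : Multiset (Elt p q)) + pairSum L + {y.1, y.2, z.2} =
        pairSum (x :: y :: z :: L) := by
      simp only [pairSum_cons, Multiset.insert_eq_cons, ← Multiset.singleton_add]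
      abel
    rw [e5] at e4
    rw [Pr_eq_univ_iff]
    omega

/-- A sequence with four products, completed by at least `(q - 3) / 2` non-commuting pairs. The four
initial products make the number of products at least `q - 1` before the last pair. -/
lemma Pr_univ_of_triple_pairs (hp : Odd p) (hq : Odd q) (hq7 : 7 ≤ q) (hχ : Function.Injective χ)
    {R : Multiset (Elt p q)} (hR : 4 ≤ (Pr χ R).card)
    {L : List (Elt p q × Elt p q)} (hL : ∀ x ∈ L, NC χ x.1 x.2)
    (hlen : q ≤ 2 * L.length + 3) : Pr χ (R + pairSum L) = Finset.univ := by
  match L, hlen, hL with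
  | [], hlen, _ => simp at hlen; omega
  | [x], hlen, _ => simp at hlen; omega
  | x :: y :: L, hlen, hL =>
    simp only [List.length_cons] at hlen
    have e3 := card_Pr_add_pairSum hp hq hq7 hχ (L := L) (fun w hw => hL w (by simp [hw]))
      (R := R) (by omega)
    have e4 : q ≤ (Pr χ (R + pairSum L + {x.1, x.2})).card + 1 := by
      by_cases h : (Pr χ (R + pairSum L)).card + 3 ≤ q
      · have := card_Pr_add_pair hp hq hq7 hχ (R := R + pairSum L) (hL x (by simp)) (by omega) h
        obtain ⟨k, hk⟩ := hq
        omega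
      · have h1 := card_Pr_add (χ := χ) (R + pairSum L) {x.1, x.2}
        have h2 := two_le_card_Pr_pair (hL x (by simp))
        omega
    have e5 := card_Pr_add (χ := χ) (R + pairSum L + {x.1, x.2}) {y.1, y.2}
    have e6 := two_le_card_Pr_pair (hL y (by simp))
    have e7 : R + pairSum L + {x.1, x.2} + {y.1, y.2} = R + pairSum (x :: y :: L) := by
      simp only [pairSum_cons]
      abel
    rw [e7] at e5
    rw [Pr_eq_univ_iff]
    omega

lemma Pr_univ_of_two_triples_pairs (hp : Odd p) (hq : Odd q) (hq7 : 7 ≤ q)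
    (hχ : Function.Injective χ) {R R' : Multiset (Elt p q)} (hR : 4 ≤ (Pr χ R).card)
    (hR' : 4 ≤ (Pr χ R').card)
    {L : List (Elt p q × Elt p q)} (hL : ∀ x ∈ L, NC χ x.1 x.2)
    (hlen : q ≤ 2 * L.length + 7) : Pr χ (R + R' + pairSum L) = Finset.univ := by
  have e3 := card_Pr_add_pairSum hp hq hq7 hχ hL (R := R) (by omega)
  have e5 := card_Pr_add (χ := χ) (R + pairSum L) R'
  rw [add_right_comm] at e5
  rw [Pr_eq_univ_iff]
  omega

/-- A sequence without the identity attains all products if every colour is avoided by at least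
`(q + 1) / 2` of its terms. -/
lemma Pr_univ_of_colors (hp : Odd p) (hq : Odd q) (hq7 : 7 ≤ q) (hχ : Function.Injective χ)
    {M : Multiset (Elt p q)} (hM : ∀ g ∈ M, g ≠ 0) (hcard : q + 1 ≤ M.card)
    (hcol : ∀ b, q + 1 ≤ 2 * M.countP (fun g => color χ g ≠ b)) : Pr χ M = Finset.univ := by
  obtain ⟨k, hk⟩ := hq
  obtain ⟨L, hL1, hL2, hL3⟩ := exists_pairs (color χ) (k + 1) M (by omega)
    (fun b => by have := hcol b; omega)
  have hmem : ∀ x ∈ L, x.1 ∈ M ∧ x.2 ∈ M := by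
    intro x hx
    have h1 : ({x.1, x.2} : Multiset (Elt p q)) ≤ pairSum L :=
      List.single_le_sum (by simp) _ (List.mem_map_of_mem hx)
    have h2 := h1.trans hL3
    exact ⟨Multiset.mem_of_le h2 (by simp), Multiset.mem_of_le h2 (by simp)⟩
  refine Pr_univ_mono hL3 (Pr_univ_of_pairs hp ⟨k, hk⟩ hq7 hχ (fun x hx => ?_) (by omega))
  have h1 := hM _ (hmem x hx).1
  have h2 := hM _ (hmem x hx).2
  exact ⟨NC_of_color_ne hχ h1 h2 (hL2 x hx), h1, h2⟩

/-- A sequence of length `q - 1` of elements of non-zero twist attains all products if every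
colour is used by at most `(q - 3) / 2` of its terms. -/
lemma Pr_univ_of_colors_twist (hp : Odd p) (hq : Odd q) (hq7 : 7 ≤ q) (hχ : Function.Injective χ)
    {M : Multiset (Elt p q)} (hM : ∀ g ∈ M, g.2 ≠ 0) (hcard : M.card + 1 = q)
    (hcol : ∀ b, 2 * M.countP (fun g => color χ g = b) + 3 ≤ q) : Pr χ M = Finset.univ := by
  obtain ⟨k, hk⟩ := hq
  have hne : ∀ g : Elt p q, g.2 ≠ 0 → g ≠ 0 := fun g hg h => hg (by rw [h]; rfl)
  obtain ⟨x, y, z, M₁, rfl, hxy, hyz, hxz, hM₁⟩ := exists_rainbow_triple (color χ) M (by omega)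
    (fun b => by have := hcol b; omega)
  simp only [Multiset.card_add, Multiset.insert_eq_cons, Multiset.card_cons,
    Multiset.card_singleton] at hcard
  obtain ⟨x', y', z', M₂, rfl, hxy', hyz', hxz', hM₂⟩ := exists_rainbow_triple (color χ) M₁
    (by omega) (fun b => by have := hM₁ b; omega)
  simp only [Multiset.card_add, Multiset.insert_eq_cons, Multiset.card_cons,
    Multiset.card_singleton] at hcard
  have m1 : ∀ g ∈ ({x, y, z} : Multiset (Elt p q)), g.2 ≠ 0 := fun g hg => hM g (by
    rw [Multiset.mem_add]; exact Or.inl hg)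
  have m2 : ∀ g ∈ ({x', y', z'} : Multiset (Elt p q)), g.2 ≠ 0 := fun g hg => hM g (by
    rw [Multiset.mem_add, Multiset.mem_add]; exact Or.inr (Or.inl hg))
  have m3 : ∀ g ∈ M₂, g.2 ≠ 0 := fun g hg => hM g (by
    rw [Multiset.mem_add, Multiset.mem_add]; exact Or.inr (Or.inr hg))
  have nc : ∀ g h : Elt p q, g.2 ≠ 0 → h.2 ≠ 0 → color χ g ≠ color χ h → NC χ g h :=
    fun g h hg hh => NC_of_color_ne hχ (hne g hg) (hne h hh)
  have t1 := four_le_card_triple hp ⟨k, hk⟩ hχ (m1 x (by simp)) (m1 y (by simp)) (m1 z (by simp))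
    (nc _ _ (m1 x (by simp)) (m1 y (by simp)) hxy) (nc _ _ (m1 y (by simp)) (m1 z (by simp)) hyz)
    (nc _ _ (m1 x (by simp)) (m1 z (by simp)) hxz)
  have t2 := four_le_card_triple hp ⟨k, hk⟩ hχ (m2 x' (by simp)) (m2 y' (by simp))
    (m2 z' (by simp)) (nc _ _ (m2 x' (by simp)) (m2 y' (by simp)) hxy')
    (nc _ _ (m2 y' (by simp)) (m2 z' (by simp)) hyz')
    (nc _ _ (m2 x' (by simp)) (m2 z' (by simp)) hxz')
  obtain ⟨L, hL1, hL2, hL3⟩ := exists_pairs (color χ) (k - 3) M₂ (by omega) (fun b => by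
    have := hM₂ b
    have := card_eq_countP_add (color χ) M₂ b
    omega)
  have hmem : ∀ w ∈ L, w.1 ∈ M₂ ∧ w.2 ∈ M₂ := by
    intro w hw
    have h1 : ({w.1, w.2} : Multiset (Elt p q)) ≤ pairSum L :=
      List.single_le_sum (by simp) _ (List.mem_map_of_mem hw)
    have h2 := h1.trans hL3
    exact ⟨Multiset.mem_of_le h2 (by simp), Multiset.mem_of_le h2 (by simp)⟩
  have hfull := Pr_univ_of_two_triples_pairs hp ⟨k, hk⟩ hq7 hχ t1 t2 (L := L)
    (fun w hw => nc _ _ (m3 _ (hmem w hw).1) (m3 _ (hmem w hw).2) (hL2 w hw)) (by omega)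
  refine Pr_univ_mono ?_ hfull
  rw [add_assoc]
  exact add_le_add le_rfl (add_le_add le_rfl hL3)

end Colours

/-! ### Growth of product sets and short product-one sequences -/

section ShortProductOne

variable {p q : ℕ} [Fact p.Prime] [Fact q.Prime] {χ : AddChar (ZMod p) (ZMod q)}

/-- A product set with at least two elements grows when a term of non-zero twist is adjoined, as
long as it has fewer than `p` elements: otherwise conjugation by that term would act on it, with
orbits of size `p` apart from one fixed point. -/
lemma card_Pr_add_singleton (hχ : Function.Injective χ) {M : Multiset (Elt p q)} {g : Elt p q}
    (hg : g.2 ≠ 0) (h2 : 2 ≤ (Pr χ M).card) :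
    min p ((Pr χ M).card + 1) ≤ (Pr χ (M + {g})).card := by
  by_contra! hlt
  rw [lt_min_iff] at hlt
  set X := Pr χ M with hX
  set E := Pr χ (M + {g}) with hE
  have hEX : E.card = X.card :=
    le_antisymm (by omega) (card_Pr_mono (Multiset.le_add_right _ _))
  set v := χ g.2 with hv
  have hv0 : v ≠ 0 := chi_ne_zero _
  have hv1 : 1 - v ≠ 0 := sub_ne_zero.2 fun h => hg ((chi_eq_one_iff hχ).1 h.symm)
  have hg1 : g.1 ∈ Pr χ {g} := by simp [Pr_singleton]
  have hright : X.image (fun x => x + χ (tw M) * g.1) = E := by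
    apply Finset.eq_of_subset_of_card_le
    · intro y hy
      obtain ⟨x, hx, rfl⟩ := Finset.mem_image.1 hy
      exact add_mem_Pr hx hg1
    · rw [Finset.card_image_of_injective _ (add_left_injective _), hEX]
  have hstep : ∀ x ∈ X, v * x + g.1 * (1 - χ (tw M)) ∈ X := by
    intro x hx
    have h1 : g.1 + v * x ∈ E := by
      have := add_mem_Pr' hx hg1
      rwa [tw_singleton] at this
    rw [← hright] at h1
    obtain ⟨y, hy, hxy⟩ := Finset.mem_image.1 h1
    have : v * x + g.1 * (1 - χ (tw M)) = y := by linear_combination -hxy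
    rwa [this]
  set f := g.1 * (1 - χ (tw M)) / (1 - v) with hf
  have hf' : f * (1 - v) = g.1 * (1 - χ (tw M)) := div_mul_cancel₀ _ hv1
  obtain ⟨x, hx, hxf⟩ : ∃ x ∈ X, x ≠ f := Finset.exists_mem_ne (by omega) f
  have hiter : ∀ k : ℕ, χ ((k : ZMod p) * g.2) * (x - f) + f ∈ X := by
    intro k
    induction k with
    | zero => simpa using hx
    | succ k ih =>
      convert hstep _ ih using 1
      rw [Nat.cast_succ, add_mul, one_mul, AddChar.map_add_eq_mul, ← hv, ← hf']
      ring
  have hcard : p ≤ X.card := by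
    have hsub : (Finset.univ : Finset (ZMod p)).image
        (fun k => χ (k * g.2) * (x - f) + f) ⊆ X := by
      intro y hy
      obtain ⟨k, -, rfl⟩ := Finset.mem_image.1 hy
      have := hiter k.val
      rwa [ZMod.natCast_zmod_val] at this
    have := Finset.card_le_card hsub
    rwa [Finset.card_image_of_injective, Finset.card_univ, ZMod.card] at this
    intro i j hij
    have h1 : χ (i * g.2) * (x - f) = χ (j * g.2) * (x - f) := add_right_cancel hij
    exact mul_right_cancel₀ hg (hχ (mul_right_cancel₀ (sub_ne_zero.2 hxf) h1))
  omega

lemma card_le_card_Pr_of_NC (hχ : Function.Injective χ) {a b : Elt p q} (hab : NC χ a b)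
    (M : Multiset (Elt p q)) (hM : ∀ g ∈ M, g.2 ≠ 0) :
    min p (M.card + 2) ≤ (Pr χ ({a, b} + M)).card := by
  induction M using Multiset.induction_on with
  | empty =>
    rw [add_zero]
    exact (min_le_right _ _).trans (two_le_card_Pr_pair hab)
  | cons g M ih =>
    have h1 := ih fun x hx => hM x (Multiset.mem_cons_of_mem hx)
    have h2 := card_Pr_add_singleton hχ (M := {a, b} + M) (hM g (Multiset.mem_cons_self _ _))
      ((two_le_card_Pr_pair hab).trans (card_Pr_mono (Multiset.le_add_right _ _)))
    rw [add_assoc, add_comm M {g}, Multiset.singleton_add] at h2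
    rw [Multiset.card_cons]
    omega

lemma ev_of_color (hχ : Function.Injective χ) {z : ZMod q} (l : List (Elt p q))
    (hl : ∀ g ∈ l, color χ g = some z) :
    ev χ l = z * (1 - χ (tw (l : Multiset (Elt p q)))) := by
  induction l with
  | nil => simp
  | cons g l ih =>
    have h1 := ((color_eq_some_iff hχ).1 (hl g List.mem_cons_self)).2
    rw [ev_cons, ih fun x hx => hl x (List.mem_cons_of_mem _ hx), h1, tw_coe_cons,
      AddChar.map_add_eq_mul]
    ring

/-- The elements of one finite colour form a cyclic group, so that only the twists matter. -/
lemma PO_of_color (hχ : Function.Injective χ) {z : ZMod q} {M : Multiset (Elt p q)}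
    (hM : ∀ g ∈ M, color χ g = some z) (htw : tw M = 0) : PO χ M := by
  refine ⟨htw, mem_Pr.2 ⟨M.toList, by simp, ?_⟩⟩
  rw [ev_of_color hχ M.toList (by simpa using hM)]
  simp [htw]

/-- A zero-sum block of length `p` is product-one or has at least `p` products. -/
lemma PO_or_le_card_Pr (hχ : Function.Injective χ) {B : Multiset (Elt p q)}
    (hB : ∀ g ∈ B, g.2 ≠ 0) (htw : tw B = 0) (hc : B.card = p) :
    PO χ B ∨ B.card ≤ (Pr χ B).card := by
  have hp := (Fact.out : p.Prime).pos
  obtain ⟨a, ha⟩ := Multiset.card_pos_iff_exists_mem.1 (by omega : 0 < B.card)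
  by_cases hcol : ∀ g ∈ B, color χ g = color χ a
  · left
    obtain ⟨z, hz⟩ := Option.ne_none_iff_exists'.1 fun h => hB a ha (color_eq_none_iff.1 h)
    exact PO_of_color hχ (z := z) (fun g hg => (hcol g hg).trans hz) htw
  · right
    push Not at hcol
    obtain ⟨b, hb, hba⟩ := hcol
    have hne : ∀ g ∈ B, g ≠ 0 := fun g hg h => hB g hg (by rw [h]; rfl)
    obtain ⟨M₁, rfl⟩ := Multiset.exists_cons_of_mem ha
    have hab : b ≠ a := fun h => hba (by rw [h])
    obtain ⟨M, rfl⟩ := Multiset.exists_cons_of_mem ((Multiset.mem_cons.1 hb).resolve_left hab)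
    have h1 := card_le_card_Pr_of_NC hχ (NC_of_color_ne hχ (hne a ha) (hne b hb) hba.symm) M
      (fun g hg => hB g (by simp [hg]))
    have h2 : ({a, b} : Multiset (Elt p q)) + M = a ::ₘ b ::ₘ M := by
      simp [Multiset.insert_eq_cons]
    rw [h2] at h1
    simp only [Multiset.card_cons] at hc ⊢
    omega

/-- A family of blocks of twist zero, each with at least as many products as terms, contains a
product-one sequence as soon as its total length is at least `q`. If no block is product-one, each
block `B` contributes `|B|` sums to those of the other blocks, by Cauchy–Davenport for
`insert 0 (Pr χ B)`. -/
lemma exists_PO_le_sum (Bs : List (Multiset (Elt p q)))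
    (hBs : ∀ B ∈ Bs, tw B = 0 ∧ 0 < B.card ∧ (PO χ B ∨ B.card ≤ (Pr χ B).card))
    (hcard : q ≤ Bs.sum.card) : ∃ M ≤ Bs.sum, M ≠ 0 ∧ PO χ M := by
  classical
  by_cases hPO : ∃ B ∈ Bs, PO χ B
  · obtain ⟨B, hB, hB1⟩ := hPO
    refine ⟨B, List.single_le_sum (by simp) _ hB, ?_, hB1⟩
    rintro rfl
    exact absurd (hBs _ hB).2.1 (by simp)
  push Not at hPO
  let Sub : List (Multiset (Elt p q)) → Finset (ZMod q) := fun Cs =>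
    Finset.univ.filter fun x => ∃ M ≤ Cs.sum, tw M = 0 ∧ x ∈ Pr χ M
  have hSub : ∀ Cs x, x ∈ Sub Cs ↔ ∃ M ≤ Cs.sum, tw M = 0 ∧ x ∈ Pr χ M := by
    intro Cs x; simp [Sub]
  have h0 : ∀ Cs, (0 : ZMod q) ∈ Sub Cs := fun Cs =>
    (hSub _ _).2 ⟨0, zero_le, rfl, mem_Pr.2 ⟨[], rfl, rfl⟩⟩
  have hgrow : ∀ Cs : List (Multiset (Elt p q)), (∀ B ∈ Cs, B ∈ Bs) →
      min q (1 + Cs.sum.card) ≤ (Sub Cs).card := by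
    intro Cs
    induction Cs with
    | nil =>
      intro _
      have := Finset.card_pos.2 ⟨_, h0 []⟩
      rw [List.sum_nil, Multiset.card_zero]
      omega
    | cons B Cs ih =>
      intro hCs
      have ih := ih fun C hC => hCs C (List.mem_cons_of_mem _ hC)
      have hB := hBs B (hCs B List.mem_cons_self)
      have hB1 := hB.2.2.resolve_left (hPO B (hCs B List.mem_cons_self))
      have hB0 : (0 : ZMod q) ∉ Pr χ B := fun h => hPO B (hCs B List.mem_cons_self) ⟨hB.1, h⟩
      have hsub : insert 0 (Pr χ B) + Sub Cs ⊆ Sub (B :: Cs) := by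
        intro z hz
        obtain ⟨x, hx, y, hy, rfl⟩ := Finset.mem_add.1 hz
        obtain ⟨M, hM, hM1, hM2⟩ := (hSub _ _).1 hy
        rw [hSub, List.sum_cons]
        rcases Finset.mem_insert.1 hx with rfl | hx
        · exact ⟨M, hM.trans (Multiset.le_add_left _ _), hM1, by rwa [zero_add]⟩
        · refine ⟨B + M, add_le_add le_rfl hM, by rw [tw_add, hB.1, hM1, add_zero], ?_⟩
          have := add_mem_Pr hx hM2
          rwa [hB.1, AddChar.map_zero_eq_one, one_mul] at this
      have h1 := ZMod.cauchy_davenport (Fact.out : q.Prime)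
        (Finset.insert_nonempty 0 (Pr χ B)) ⟨_, h0 Cs⟩
      have h2 := Finset.card_le_card hsub
      rw [Finset.card_insert_of_notMem hB0] at h1
      rw [List.sum_cons, Multiset.card_add]
      omega
  match Bs, hBs, hcard, hPO, hgrow with
  | [], _, hcard, _, _ =>
    have := (Fact.out : q.Prime).pos
    simp at hcard
    omega
  | B :: Cs, hBs, hcard, hPO, hgrow =>
    have hB := hBs B List.mem_cons_self
    have hB1 := hB.2.2.resolve_left (hPO B List.mem_cons_self)
    have h1 := hgrow Cs fun C hC => List.mem_cons_of_mem _ hC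
    rw [List.sum_cons, Multiset.card_add] at hcard
    have h2 : ((Pr χ B).image fun x => -x).card = (Pr χ B).card :=
      Finset.card_image_of_injective _ neg_injective
    have hint : (((Pr χ B).image fun x => -x) ∩ Sub Cs).Nonempty := by
      rw [← Finset.card_pos]
      have h3 := Finset.card_union_add_card_inter ((Pr χ B).image fun x => -x) (Sub Cs)
      have h4 := Finset.card_le_univ (((Pr χ B).image fun x => -x) ∪ Sub Cs)
      rw [ZMod.card] at h4
      have h5 := (Pr_nonempty (χ := χ) B).card_pos
      omega
    obtain ⟨y, hy⟩ := hint
    rw [Finset.mem_inter] at hy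
    obtain ⟨x, hx, rfl⟩ := Finset.mem_image.1 hy.1
    obtain ⟨M, hM, hM1, hM2⟩ := (hSub _ _).1 hy.2
    refine ⟨B + M, ?_, ?_, by rw [tw_add, hB.1, hM1, add_zero], ?_⟩
    · rw [List.sum_cons]; exact add_le_add le_rfl hM
    · intro h
      have := congrArg Multiset.card h
      rw [Multiset.card_add, Multiset.card_zero] at this
      omega
    · have := add_mem_Pr hx hM2
      rwa [hB.1, AddChar.map_zero_eq_one, one_mul, add_neg_cancel] at this

lemma exists_le_of_le_map {α β : Type*} (f : α → β) {t : Multiset β} :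
    ∀ {S : Multiset α}, t ≤ S.map f → ∃ B ≤ S, B.map f = t := by
  induction t using Multiset.induction_on with
  | empty => intro S _; exact ⟨0, zero_le, rfl⟩
  | cons a t ih =>
    intro S h
    obtain ⟨s, hs, rfl⟩ := Multiset.mem_map.1 (Multiset.mem_of_le h (Multiset.mem_cons_self _ _))
    obtain ⟨S, rfl⟩ := Multiset.exists_cons_of_mem hs
    rw [Multiset.map_cons, Multiset.cons_le_cons_iff] at h
    obtain ⟨B, hB, rfl⟩ := ih h
    exact ⟨s ::ₘ B, Multiset.cons_le_cons _ hB, by simp⟩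

/-- Repeated application of the Erdős–Ginzburg–Ziv theorem to the twists. -/
lemma exists_blocks (j : ℕ) : ∀ U : Multiset (Elt p q), j * p + p ≤ U.card →
    ∃ Bs : List (Multiset (Elt p q)), Bs.length = j ∧ (∀ B ∈ Bs, tw B = 0 ∧ B.card = p) ∧
      Bs.sum ≤ U := by
  induction j with
  | zero => intro U _; exact ⟨[], rfl, by simp, by simp⟩
  | succ j ih =>
    intro U hU
    rw [Nat.add_mul, one_mul] at hU
    obtain ⟨t, ht, ht1, ht2⟩ := ZMod.erdos_ginzburg_ziv_multiset (n := p) (U.map Prod.snd)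
      (by rw [Multiset.card_map]; omega)
    obtain ⟨B, hB, rfl⟩ := exists_le_of_le_map _ ht
    obtain ⟨U', rfl⟩ := Multiset.le_iff_exists_add.1 hB
    rw [Multiset.card_map] at ht1
    rw [Multiset.card_add] at hU
    obtain ⟨Bs, h1, h2, h3⟩ := ih U' (by omega)
    refine ⟨B :: Bs, by simp [h1], ?_, ?_⟩
    · intro C hC
      rcases List.mem_cons.1 hC with rfl | hC
      · exact ⟨ht2, ht1⟩
      · exact h2 C hC
    · rw [List.sum_cons]; exact add_le_add le_rfl h3

/-- The twists of the prefixes of a list. -/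
def prefixTw (l : List (Elt p q)) : Finset (ZMod p) :=
  (Finset.range (l.length + 1)).image fun k =>
    tw ((l.take k : List (Elt p q)) : Multiset (Elt p q))

lemma exists_of_mem_prefixTw {l : List (Elt p q)} {α : ZMod p} (h : α ∈ prefixTw l) :
    ∃ l₁ l₂, l = l₁ ++ l₂ ∧ tw (l₁ : Multiset (Elt p q)) = α := by
  obtain ⟨k, -, rfl⟩ := Finset.mem_image.1 h
  exact ⟨l.take k, l.drop k, (List.take_append_drop _ _).symm, rfl⟩

/-- In a zero-sum free sequence all prefixes have different twists. -/
lemma card_prefixTw {l : List (Elt p q)}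
    (hl : ∀ N : Multiset (Elt p q), N ≤ l → N ≠ 0 → tw N ≠ 0) :
    (prefixTw l).card = l.length + 1 := by
  unfold prefixTw
  have key : ∀ i j : ℕ, i < j → j ≤ l.length →
      tw ((l.take i : List (Elt p q)) : Multiset (Elt p q)) ≠
      tw ((l.take j : List (Elt p q)) : Multiset (Elt p q)) := by
    intro i j hij hj h
    have h1 : l.take j = l.take i ++ (l.take j).drop i := by
      conv_lhs => rw [← List.take_append_drop i (l.take j)]
      rw [List.take_take, min_eq_left hij.le]
    have h2 : tw (((l.take j).drop i : List (Elt p q)) : Multiset (Elt p q)) = 0 := by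
      rw [h1, tw_coe_append] at h
      simpa using h
    refine hl _ ?_ ?_ h2
    · exact ((List.drop_sublist _ _).trans (List.take_sublist _ _)).subperm
    · intro h3
      have := congrArg Multiset.card h3
      rw [Multiset.coe_card, List.length_drop, List.length_take, Multiset.card_zero] at this
      omega
  rw [Finset.card_image_of_injOn, Finset.card_range]
  intro i hi j hj hij
  have hi' := Finset.mem_range.1 (Finset.mem_coe.1 hi)
  have hj' := Finset.mem_range.1 (Finset.mem_coe.1 hj)
  rcases lt_trichotomy i j with h | h | h
  · exact absurd hij (key i j h (by omega))
  · exact h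
  · exact absurd hij.symm (key j i h (by omega))

lemma exists_tw_eq_zero {M : Multiset (Elt p q)} (hM : p ≤ M.card) :
    ∃ N ≤ M, N ≠ 0 ∧ N.card ≤ p ∧ tw N = 0 := by
  by_contra! hcon
  have hlen : (M.toList.take p).length = p := by simp [hM]
  have hle : ((M.toList.take p : List (Elt p q)) : Multiset (Elt p q)) ≤ M := by
    conv_rhs => rw [← Multiset.coe_toList M]
    exact (List.take_sublist _ _).subperm
  have h1 := card_prefixTw (l := M.toList.take p) (fun N hN hN0 =>
    hcon N (hN.trans hle) hN0 (by simpa [hlen] using Multiset.card_le_card hN))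
  have h2 := Finset.card_le_univ (prefixTw (M.toList.take p))
  rw [ZMod.card] at h2
  omega

end ShortProductOne

/-! ### Sequences with a popular colour -/

section PopularColour

variable {p q : ℕ} [Fact p.Prime] [Fact q.Prime] {χ : AddChar (ZMod p) (ZMod q)}

lemma exists_le_card {α : Type*} {M : Multiset α} {n : ℕ} (h : n ≤ M.card) :
    ∃ N ≤ M, N.card = n := by
  refine ⟨(M.toList.take n : List α), ?_, by simp [h]⟩
  conv_rhs => rw [← Multiset.coe_toList M]
  exact (List.take_sublist _ _).subperm

/-- Conjugation by the translation `x ↦ x - z`, which moves the fixed point `z` to `0`. -/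
def translate (χ : AddChar (ZMod p) (ZMod q)) (z : ZMod q) (g : Elt p q) : Elt p q :=
  (g.1 - z * (1 - χ g.2), g.2)

lemma ev_map_translate (z : ZMod q) (l : List (Elt p q)) :
    ev χ (l.map (translate χ z)) = ev χ l - z * (1 - χ (tw (l : Multiset (Elt p q)))) := by
  induction l with
  | nil => simp
  | cons g l ih =>
    rw [List.map_cons, ev_cons, ih, ev_cons, tw_coe_cons, AddChar.map_add_eq_mul]
    simp only [translate]
    ring

lemma tw_map_translate (z : ZMod q) (S : Multiset (Elt p q)) :
    tw (S.map (translate χ z)) = tw S := by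
  simp only [tw, Multiset.map_map]
  rfl

lemma PO.map_translate (z : ZMod q) {S : Multiset (Elt p q)} (h : PO χ S) :
    PO χ (S.map (translate χ z)) := by
  obtain ⟨h1, h2⟩ := h
  obtain ⟨l, rfl, hl⟩ := mem_Pr.1 h2
  refine ⟨by rw [tw_map_translate, h1], mem_Pr.2 ⟨l.map (translate χ z), rfl, ?_⟩⟩
  rw [ev_map_translate, hl, h1]
  simp

lemma PO_of_map_translate (z : ZMod q) {S : Multiset (Elt p q)}
    (h : PO χ (S.map (translate χ z))) : PO χ S := by
  have := h.map_translate (-z)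
  rw [Multiset.map_map] at this
  convert this using 1
  conv_lhs => rw [← Multiset.map_id S]
  refine Multiset.map_congr rfl fun g _ => ?_
  refine Prod.ext ?_ rfl
  simp [translate]

lemma translate_fst_eq_zero_iff (hχ : Function.Injective χ) {z : ZMod q} {g : Elt p q}
    (hg : g ≠ 0) : (translate χ z g).1 = 0 ↔ color χ g = some z := by
  rw [color_eq_some_iff hχ]
  simp only [translate]
  rw [sub_eq_zero]
  refine ⟨fun h => ⟨fun h2 => hg (Prod.ext ?_ h2), h⟩, fun h => h.2⟩
  rw [h, h2]
  simp

lemma ev_eq_zero_of_fst {l : List (Elt p q)} (hl : ∀ g ∈ l, g.1 = 0) : ev χ l = 0 := by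
  induction l with
  | nil => rfl
  | cons g l ih =>
    rw [ev_cons, hl g List.mem_cons_self, ih fun x hx => hl x (List.mem_cons_of_mem _ hx)]
    ring

/-- The sub-sequences of `n` terms of non-zero twist attain at least `n + 1` twists, or all. -/
lemma card_subsums (C : Multiset (Elt p q)) (hC : ∀ g ∈ C, g.2 ≠ 0) :
    ∃ A : Finset (ZMod p), min p (C.card + 1) ≤ A.card ∧ ∀ α ∈ A, ∃ D ≤ C, tw D = α := by
  induction C using Multiset.induction_on with
  | empty =>
    refine ⟨{0}, by simp, fun α hα => ⟨0, le_rfl, ?_⟩⟩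
    rw [Finset.mem_singleton.1 hα]; rfl
  | cons g C ih =>
    obtain ⟨A, hA, hA'⟩ := ih fun x hx => hC x (Multiset.mem_cons_of_mem hx)
    have hg := hC g (Multiset.mem_cons_self _ _)
    have hp := (Fact.out : p.Prime).pos
    have h1 := ZMod.cauchy_davenport (Fact.out : p.Prime) (Finset.card_pos.1 (by omega : 0 < A.card))
      (Finset.insert_nonempty 0 {g.2})
    rw [Finset.card_pair (Ne.symm hg)] at h1
    refine ⟨A + {0, g.2}, by rw [Multiset.card_cons]; omega, fun α hα => ?_⟩
    obtain ⟨a, ha, b, hb, rfl⟩ := Finset.mem_add.1 hα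
    obtain ⟨D, hD, rfl⟩ := hA' a ha
    rcases Finset.mem_insert.1 hb with rfl | hb
    · exact ⟨D, hD.trans (Multiset.le_cons_self _ _), by simp⟩
    · rw [Finset.mem_singleton.1 hb]
      exact ⟨g ::ₘ D, Multiset.cons_le_cons _ hD, by rw [tw_cons, add_comm]⟩

lemma mul_mem_Pr {y : Elt p q} {C D : Multiset (Elt p q)} (hC : ∀ g ∈ C, g.1 = 0) (hD : D ≤ C) :
    χ (tw D) * y.1 ∈ Pr χ ({y} + C) := by
  obtain ⟨D', rfl⟩ := Multiset.le_iff_exists_add.1 hD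
  refine mem_Pr.2 ⟨D.toList ++ y :: D'.toList, ?_, ?_⟩
  · rw [← Multiset.coe_add, ← Multiset.cons_coe, Multiset.coe_toList, Multiset.coe_toList,
      Multiset.add_cons, Multiset.singleton_add]
  · rw [ev_append, ev_cons, ev_eq_zero_of_fst fun g hg => hC g (by simpa using Or.inl hg),
      ev_eq_zero_of_fst fun g hg => hC g (by simpa using Or.inr hg), Multiset.coe_toList]
    ring

/-- The terms of `C` may be placed before or after `y`, which multiplies `y.1` by different values
of `χ`. -/
lemma card_Pr_singleton_add {y : Elt p q} (hχ : Function.Injective χ) (hy : y.1 ≠ 0)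
    {C : Multiset (Elt p q)} (hC : ∀ g ∈ C, g.1 = 0 ∧ g.2 ≠ 0) :
    min p (C.card + 1) ≤ (Pr χ ({y} + C)).card := by
  obtain ⟨A, hA, hA'⟩ := card_subsums C fun g hg => (hC g hg).2
  have hsub : A.image (fun α => χ α * y.1) ⊆ Pr χ ({y} + C) := by
    intro x hx
    obtain ⟨α, hα, rfl⟩ := Finset.mem_image.1 hx
    obtain ⟨D, hD, rfl⟩ := hA' α hα
    exact mul_mem_Pr (fun g hg => (hC g hg).1) hD
  have h1 := Finset.card_le_card hsub
  rw [Finset.card_image_of_injective] at h1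
  · exact hA.trans h1
  · intro a b hab
    exact hχ (mul_right_cancel₀ hy hab)

/-- Terms with fixed point `0` each contribute one product, provided that there is one term with
another fixed point for every `p - 1` of them. -/
lemma card_Pr_add_of_fst (hχ : Function.Injective χ) (Y : Multiset (Elt p q)) :
    ∀ C : Multiset (Elt p q), (∀ g ∈ Y, g.1 ≠ 0) → (∀ g ∈ C, g.1 = 0 ∧ g.2 ≠ 0) →
    C.card ≤ (p - 1) * Y.card → min q (1 + C.card) ≤ (Pr χ (Y + C)).card := by
  induction Y using Multiset.induction_on with
  | empty =>
    intro C _ _ hcard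
    have := (Pr_nonempty (χ := χ) (0 + C)).card_pos
    simp only [Multiset.card_zero, mul_zero] at hcard
    omega
  | cons y Y ih =>
    intro C hY hC hcard
    obtain ⟨C₁, hC₁, hc₁⟩ := exists_le_card (min_le_right (p - 1) C.card)
    obtain ⟨C₂, rfl⟩ := Multiset.le_iff_exists_add.1 hC₁
    rw [Multiset.card_cons, mul_add, mul_one, Multiset.card_add] at hcard
    rw [Multiset.card_add] at hc₁
    have h1 := ih C₂ (fun g hg => hY g (Multiset.mem_cons_of_mem hg))
      (fun g hg => hC g (by simp [hg])) (by omega)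
    have h2 := card_Pr_singleton_add hχ (hY y (Multiset.mem_cons_self _ _)) (C := C₁)
      (fun g hg => hC g (by simp [hg]))
    have h3 := card_Pr_add (χ := χ) ({y} + C₁) (Y + C₂)
    have h4 : ({y} + C₁) + (Y + C₂) = y ::ₘ Y + (C₁ + C₂) := by
      rw [← Multiset.singleton_add]; abel
    rw [h4] at h3
    have hp := (Fact.out : p.Prime).pos
    rw [Multiset.card_add]
    omega

/-- All sums `∑ χ (e y) * y.1` over the terms `y` of a sequence, with arbitrary exponents `e`. -/
def orbitSum (χ : AddChar (ZMod p) (ZMod q)) (Y : Multiset (Elt p q)) : Finset (ZMod q) :=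
  (Y.map fun y => Finset.univ.image fun e : ZMod p => χ e * y.1).sum

lemma mem_orbitSum_cons {y : Elt p q} {Y : Multiset (Elt p q)} {x : ZMod q} :
    x ∈ orbitSum χ (y ::ₘ Y) ↔ ∃ e, ∃ x' ∈ orbitSum χ Y, χ e * y.1 + x' = x := by
  simp [orbitSum, Finset.mem_add]

lemma mul_mem_orbitSum {Y : Multiset (Elt p q)} (i : ZMod p) {x : ZMod q}
    (hx : x ∈ orbitSum χ Y) : χ i * x ∈ orbitSum χ Y := by
  induction Y using Multiset.induction_on generalizing x with
  | empty =>
    have : x = 0 := by simpa [orbitSum] using hx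
    rw [this, mul_zero]
    simp [orbitSum]
  | cons y Y ih =>
    obtain ⟨e, x', hx', rfl⟩ := mem_orbitSum_cons.1 hx
    refine mem_orbitSum_cons.2 ⟨i + e, χ i * x', ih hx', ?_⟩
    rw [AddChar.map_add_eq_mul]
    ring

/-- In any product the first coordinate of each term gets multiplied by a value of `χ`, so that
terms with vanishing first coordinate can only affect the exponents. -/
lemma Pr_subset_orbitSum (S : Multiset (Elt p q)) :
    Pr χ S ⊆ orbitSum χ (S.filter fun g => g.1 ≠ 0) := by
  intro x hx
  obtain ⟨l, rfl, rfl⟩ := mem_Pr.1 hx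
  clear hx
  induction l with
  | nil => simp [orbitSum]
  | cons g l ih =>
    rw [← Multiset.cons_coe, ev_cons]
    by_cases hg : g.1 = 0
    · rw [Multiset.filter_cons_of_neg (p := fun g : Elt p q => g.1 ≠ 0) _ (not_not.2 hg), hg,
        zero_add]
      exact mul_mem_orbitSum _ ih
    · rw [Multiset.filter_cons_of_pos (p := fun g : Elt p q => g.1 ≠ 0) _ hg]
      exact mem_orbitSum_cons.2 ⟨0, _, mul_mem_orbitSum g.2 ih, by simp⟩

/-- With `p - 1` terms of fixed point `0` at hand for each term of `Y`, all exponents can be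
prescribed. -/
lemma orbitSum_subset_Pr (Y : Multiset (Elt p q)) :
    ∀ C : Multiset (Elt p q), (∀ g ∈ C, g.1 = 0 ∧ g.2 ≠ 0) →
    (p - 1) * Y.card ≤ C.card → orbitSum χ Y ⊆ Pr χ (Y + C) := by
  induction Y using Multiset.induction_on with
  | empty =>
    intro C hC _ x hx
    have : x = 0 := by simpa [orbitSum] using hx
    rw [this]
    refine mem_Pr.2 ⟨C.toList, by simp, ev_eq_zero_of_fst fun g hg => (hC g (by simpa using hg)).1⟩
  | cons y Y ih =>
    intro C hC hcard x hx
    obtain ⟨e, x', hx', rfl⟩ := mem_orbitSum_cons.1 hx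
    rw [Multiset.card_cons, mul_add, mul_one] at hcard
    obtain ⟨C₁, hC₁, hc₁⟩ := exists_le_card (le_trans (Nat.le_add_left _ _) hcard)
    obtain ⟨C₂, rfl⟩ := Multiset.le_iff_exists_add.1 hC₁
    rw [Multiset.card_add] at hcard
    obtain ⟨A, hA, hA'⟩ := card_subsums C₁ fun g hg => (hC g (by simp [hg])).2
    have hp := (Fact.out : p.Prime).pos
    have hAu : A = Finset.univ := by
      apply Finset.eq_univ_of_card
      have := Finset.card_le_univ A
      rw [ZMod.card] at *
      omega
    obtain ⟨D, hD, hDe⟩ := hA' e (by simp [hAu])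
    have h1 := mul_mem_Pr (χ := χ) (y := y) (C := C₁) (fun g hg => (hC g (by simp [hg])).1) hD
    have h2 := ih C₂ (fun g hg => hC g (by simp [hg])) (by omega)
      (mul_mem_orbitSum (-(tw ({y} + C₁))) hx')
    have h3 := add_mem_Pr h1 h2
    rw [← mul_assoc, chi_mul_neg, one_mul, hDe] at h3
    have h4 : ({y} + C₁) + (Y + C₂) = y ::ₘ Y + (C₁ + C₂) := by
      rw [← Multiset.singleton_add]; abel
    rwa [h4] at h3

/-- If one colour is used by more than half of the terms, a short zero-sum subsequence of this
colour can be split off: the complement attains all products if it has enough terms of other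
colours, and otherwise the terms of the popular colour are so numerous that the complement still
attains every product of the whole sequence. -/
lemma exists_split_of_popular (hp : Odd p) (hq : Odd q) (hχ : Function.Injective χ)
    (hpq : 2 * p + 1 ≤ q) {S : Multiset (Elt p q)} (hS : ∀ g ∈ S, g ≠ 0) (hcard : S.card = 2 * q)
    (hPO : PO χ S) {z : ZMod q} (hz : q + 1 ≤ S.countP (fun g => color χ g = some z)) :
    ∃ A B : Multiset (Elt p q), A ≠ 0 ∧ B ≠ 0 ∧ PO χ A ∧ PO χ B ∧ S = A + B := by
  have hp3 : 3 ≤ p := by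
    have := (Fact.out : p.Prime).two_le
    obtain ⟨k, hk⟩ := hp
    omega
  have hzc := hz
  rw [Multiset.countP_eq_card_filter] at hzc
  obtain ⟨T, hT, hT0, hTp, hTtw⟩ := exists_tw_eq_zero (M := S.filter fun g => color χ g = some z)
    (by omega)
  have hTz : ∀ g ∈ T, color χ g = some z := fun g hg => by
    have := Multiset.mem_of_le hT hg
    exact (Multiset.mem_filter.1 this).2
  obtain ⟨R, rfl⟩ := Multiset.le_iff_exists_add.1 (hT.trans (Multiset.filter_le _ _))
  have hTPO : PO χ T := PO_of_color hχ hTz hTtw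
  have htwR : tw R = 0 := by
    have := hPO.1
    rwa [tw_add, hTtw, zero_add] at this
  have hT1 := Multiset.card_pos.2 hT0
  have hTc : T.countP (fun g => color χ g = some z) = T.card := Multiset.countP_eq_card.2 hTz
  rw [Multiset.card_add] at hcard
  rw [Multiset.countP_add, hTc] at hz
  have hRc := card_eq_countP_add (color χ) R (some z)
  set n := R.countP (fun g => color χ g = some z) with hn
  set m := R.countP (fun g => color χ g ≠ some z) with hm
  refine ⟨T, R, hT0, Multiset.card_pos.1 (by omega), hTPO, ⟨htwR, ?_⟩, rfl⟩
  by_cases hmq : q + 1 ≤ 2 * m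
  · rw [Pr_univ_of_colors hp hq (by omega) hχ (M := R) (fun g hg => hS g (by simp [hg])) (by omega)]
    · exact Finset.mem_univ _
    · intro b
      by_cases hb : b = some z
      · rw [hb]; exact hmq
      · have : n ≤ R.countP (fun g => color χ g ≠ b) := by
          rw [hn, Multiset.countP_eq_card_filter, Multiset.countP_eq_card_filter]
          refine Multiset.card_le_card (Multiset.monotone_filter_right _ fun g hg => ?_)
          rw [hg]; exact Ne.symm hb
        omega
  -- few terms of other colours: move the fixed point `z` to `0`
  · set τ := translate χ z with hτ
    set C := (R.map τ).filter (fun g => g.1 = 0) with hC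
    set Y := (R.map τ).filter (fun g => ¬ g.1 = 0) with hY
    have hRCY : R.map τ = Y + C := by
      rw [add_comm]; exact (Multiset.filter_add_not _ _).symm
    have hτ0 : ∀ g ∈ R, ((τ g).1 = 0 ↔ color χ g = some z) := fun g hg =>
      translate_fst_eq_zero_iff hχ (hS g (by simp [hg]))
    have hCn : C.card = n := by
      rw [hC, Multiset.filter_map, Multiset.card_map, hn, Multiset.countP_eq_card_filter]
      congr 1
      exact Multiset.filter_congr hτ0
    have hYm : Y.card = m := by
      have := congrArg Multiset.card hRCY
      rw [Multiset.card_map, Multiset.card_add] at this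
      omega
    have hC' : ∀ g ∈ C, g.1 = 0 ∧ g.2 ≠ 0 := by
      intro g hg
      obtain ⟨hg1, hg2⟩ := Multiset.mem_filter.1 hg
      obtain ⟨h, hh, rfl⟩ := Multiset.mem_map.1 hg1
      exact ⟨hg2, ((color_eq_some_iff hχ).1 ((hτ0 h hh).1 hg2)).1⟩
    have hY' : ∀ g ∈ Y, g.1 ≠ 0 := fun g hg => (Multiset.mem_filter.1 hg).2
    suffices h : (0 : ZMod q) ∈ Pr χ (R.map τ) from
      (PO_of_map_translate z ⟨by rw [tw_map_translate, htwR], h⟩).2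
    rw [hRCY]
    by_cases hpm : q - 1 ≤ (p - 1) * m
    · obtain ⟨C₀, hC₀, hc₀⟩ := exists_le_card (M := C) (n := q - 1) (by omega)
      have h1 := card_Pr_add_of_fst hχ Y C₀ hY' (fun g hg => hC' g (Multiset.mem_of_le hC₀ hg))
        (by rw [hc₀, hYm]; exact hpm)
      rw [hc₀, Nat.add_sub_cancel' (by omega), min_self] at h1
      rw [Pr_univ_mono (add_le_add le_rfl hC₀) (Pr_eq_univ_iff.2 h1)]
      exact Finset.mem_univ _
    · apply orbitSum_subset_Pr Y C hC' (by rw [hYm]; omega)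
      have h1 := Pr_subset_orbitSum _ (hPO.map_translate z).2
      rw [Multiset.map_add, Multiset.filter_add, Multiset.filter_eq_nil.2, zero_add] at h1
      · exact h1
      · intro g hg
        obtain ⟨h, hh, rfl⟩ := Multiset.mem_map.1 hg
        rw [not_not]
        exact (translate_fst_eq_zero_iff hχ (hS h (by simp [hh]))).2 (hTz h hh)

end PopularColour

/-! ### Splitting a sequence over `ZMod q ⋊ ZMod p` -/

section Splitting

variable {p q : ℕ} [Fact p.Prime] [Fact q.Prime] {χ : AddChar (ZMod p) (ZMod q)}

lemma Pr_univ_of_two_prefixes (hχ : Function.Injective χ) {g : Elt p q} (hg : g.2 ≠ 0)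
    {T : Multiset (Elt p q)} (hT : ∀ g ∈ T, g.2 = 0 ∧ g.1 ≠ 0) (hq : q ≤ 1 + T.card) :
    Pr χ ({g} + T) = Finset.univ := by
  rw [Pr_eq_univ_iff]
  have h1 := card_Pr_of_prefixes hχ [g] {0, g.2} (Finset.insert_nonempty _ _) (by
    intro α hα
    simp only [Finset.mem_insert, Finset.mem_singleton] at hα
    rcases hα with rfl | rfl
    · exact ⟨[], [g], rfl, rfl⟩
    · exact ⟨[g], [], rfl, by simp⟩) T hT
  rw [Finset.card_pair (Ne.symm hg), Multiset.coe_singleton] at h1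
  omega

/-- Among three terms of non-zero twist there are two with non-zero twist sum. Their prefixes have
three different twists, so that each term of twist zero contributes two products. -/
lemma Pr_univ_of_three_prefixes (hp : Odd p) (hχ : Function.Injective χ)
    {U T : Multiset (Elt p q)} (hU : ∀ g ∈ U, g.2 ≠ 0) (hU3 : 3 ≤ U.card)
    (hT : ∀ g ∈ T, g.2 = 0 ∧ g.1 ≠ 0) (hq : q ≤ 1 + 2 * T.card) :
    Pr χ (U + T) = Finset.univ := by
  obtain ⟨N, hN, hNc⟩ := exists_le_card hU3
  obtain ⟨a, b, c, rfl⟩ := Multiset.card_eq_three.1 hNc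
  have key : ∀ x y : Elt p q, ({x, y} : Multiset (Elt p q)) ≤ {a, b, c} → x.2 + y.2 ≠ 0 →
      Pr χ (U + T) = Finset.univ := by
    intro x y hxy hne
    have hx : x.2 ≠ 0 := hU x (Multiset.mem_of_le (hxy.trans hN) (by simp))
    have hy : y.2 ≠ 0 := hU y (Multiset.mem_of_le (hxy.trans hN) (by simp))
    have h1 := card_Pr_of_prefixes hχ [x, y] {0, x.2, x.2 + y.2} (Finset.insert_nonempty _ _) (by
      intro α hα
      simp only [Finset.mem_insert, Finset.mem_singleton] at hα
      rcases hα with rfl | rfl | rfl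
      · exact ⟨[], [x, y], rfl, rfl⟩
      · exact ⟨[x], [y], rfl, by simp⟩
      · exact ⟨[x, y], [], rfl, by simp⟩) T hT
    rw [Finset.card_insert_of_notMem (by simp [Ne.symm hx, Ne.symm hne]),
      Finset.card_pair (by simpa using hy)] at h1
    refine Pr_univ_mono (A := (([x, y] : List (Elt p q)) : Multiset (Elt p q)) + T)
      (add_le_add (hxy.trans hN) le_rfl) (Pr_eq_univ_iff.2 ?_)
    omega
  by_cases h1 : a.2 + b.2 = 0
  · by_cases h2 : a.2 + c.2 = 0
    · refine key b c (Multiset.le_cons_self _ _) ?_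
      have h3 : b.2 = c.2 := by
        rw [h1.symm] at h2; exact (add_left_cancel h2).symm
      rw [h3]
      exact add_self_ne_zero hp (hU c (Multiset.mem_of_le hN (by simp)))
    · exact key a c (Multiset.cons_le_cons _ (Multiset.le_cons_self _ _)) h2
  · refine key a b ?_ h1
    exact Multiset.cons_le_cons _ (Multiset.singleton_le.2 (by simp))

/-- A sequence of length `q` attains all products if the terms of twist zero and every finite
colour are not too frequent. With three colours of non-zero twist this follows from
`Pr_univ_of_triple_pairs`; with at most two, the terms of the more frequent one
have many prefixes, at which the terms of twist zero can be inserted. -/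
lemma Pr_univ_of_few_colors (hp : Odd p) (hq : Odd q) (hχ : Function.Injective χ)
    (hpq : 2 * p + 1 ≤ q) {U T : Multiset (Elt p q)} (hU : ∀ g ∈ U, g.2 ≠ 0)
    (hT : ∀ g ∈ T, g.2 = 0 ∧ g.1 ≠ 0) (hcard : U.card + T.card = q) (hTc : 2 * T.card + 3 ≤ q)
    (hcol : ∀ z, U.countP (fun g => color χ g = some z) + 1 ≤ p)
    (hfree : ∀ z, ∀ N ≤ U.filter (fun g => color χ g = some z), N ≠ 0 → tw N ≠ 0) :
    Pr χ (U + T) = Finset.univ := by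
  have hp3 : 3 ≤ p := by
    have := (Fact.out : p.Prime).two_le
    obtain ⟨k, hk⟩ := hp
    omega
  have hne : ∀ g : Elt p q, g.2 ≠ 0 → g ≠ 0 := fun g hg h => hg (by rw [h]; rfl)
  have hTcol : ∀ z, T.countP (fun g => color χ g = some z) = 0 := fun z => by
    rw [Multiset.countP_eq_zero]
    intro g hg h
    rw [color_eq_none_iff.2 (hT g hg).1] at h
    exact absurd h (by simp)
  have hUcol : U.countP (fun g => color χ g = none) = 0 := by
    rw [Multiset.countP_eq_zero]
    intro g hg h
    exact hU g hg (color_eq_none_iff.1 h)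
  by_cases h3 : ∃ a ∈ U, ∃ b ∈ U, ∃ c ∈ U, color χ a ≠ color χ b ∧ color χ b ≠ color χ c ∧
      color χ a ≠ color χ c
  · obtain ⟨a, ha, b, hb, c, hc, hab, hbc, hac⟩ := h3
    have nc : ∀ g ∈ U, ∀ h ∈ U, color χ g ≠ color χ h → NC χ g h :=
      fun g hg h hh => NC_of_color_ne hχ (hne g (hU g hg)) (hne h (hU h hh))
    have h4 := four_le_card_triple hp hq hχ (hU a ha) (hU b hb) (hU c hc) (nc a ha b hb hab)
      (nc b hb c hc hbc) (nc a ha c hc hac)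
    have eba : b ≠ a := fun h => hab (by rw [h])
    have eca : c ≠ a := fun h => hac (by rw [h])
    have ecb : c ≠ b := fun h => hbc (by rw [h])
    obtain ⟨U₁, rfl⟩ := Multiset.exists_cons_of_mem ha
    obtain ⟨U₂, rfl⟩ := Multiset.exists_cons_of_mem ((Multiset.mem_cons.1 hb).resolve_left eba)
    obtain ⟨M, rfl⟩ := Multiset.exists_cons_of_mem
      ((Multiset.mem_cons.1 ((Multiset.mem_cons.1 hc).resolve_left eca)).resolve_left ecb)
    have hsum : a ::ₘ b ::ₘ c ::ₘ M + T = {a, b, c} + (M + T) := by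
      simp [Multiset.insert_eq_cons]
    have hMT : ∀ β, 2 * (M + T).countP (fun g => color χ g = β) + 3 ≤ q := by
      intro β
      rw [Multiset.countP_add]
      rcases β with _ | z
      · have h5 : M.countP (fun g => color χ g = none) ≤ 0 := hUcol ▸
          Multiset.countP_le_of_le _ (((Multiset.le_cons_self _ _).trans
            (Multiset.le_cons_self _ _)).trans (Multiset.le_cons_self _ _))
        have h6 := Multiset.countP_le_card (fun g => color χ g = none) T
        omega
      · have h5 : M.countP (fun g => color χ g = some z) ≤
            (a ::ₘ b ::ₘ c ::ₘ M).countP (fun g => color χ g = some z) :=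
          Multiset.countP_le_of_le _ (((Multiset.le_cons_self _ _).trans
            (Multiset.le_cons_self _ _)).trans (Multiset.le_cons_self _ _))
        have h6 := hcol z
        have h7 := hTcol z
        omega
    simp only [Multiset.card_cons] at hcard
    obtain ⟨k, hk⟩ := hq
    have hMTc : (M + T).card = 2 * (k - 1) := by rw [Multiset.card_add]; omega
    obtain ⟨L, hL1, hL2, hL3⟩ := exists_pairs (color χ) (k - 1) (M + T) hMTc.ge (fun β => by
      have h5 := hMT β
      have h6 := card_eq_countP_add (color χ) (M + T) β
      omega)
    have hne' : ∀ g ∈ M + T, g ≠ 0 := by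
      intro g hg
      rcases Multiset.mem_add.1 hg with hg | hg
      · exact hne g (hU g (by simp [hg]))
      · exact fun h => (hT g hg).2 (by rw [h]; rfl)
    have hmem : ∀ x ∈ L, x.1 ∈ M + T ∧ x.2 ∈ M + T := by
      intro x hx
      have h1 : ({x.1, x.2} : Multiset (Elt p q)) ≤ pairSum L :=
        List.single_le_sum (by simp) _ (List.mem_map_of_mem hx)
      have h2 := h1.trans hL3
      exact ⟨Multiset.mem_of_le h2 (by simp), Multiset.mem_of_le h2 (by simp)⟩
    rw [hsum]
    refine Pr_univ_mono (add_le_add le_rfl hL3) (Pr_univ_of_triple_pairs hp ⟨k, hk⟩ (by omega) hχ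
      h4 (fun x hx => ?_) (by omega))
    exact NC_of_color_ne hχ (hne' _ (hmem x hx).1) (hne' _ (hmem x hx).2) (hL2 x hx)
  · push Not at h3
    -- at most two colours: one of them is used by at least half of the terms of `U`
    obtain ⟨z, hz⟩ : ∃ z, U.card ≤ 2 * U.countP (fun g => color χ g = some z) := by
      obtain ⟨a, ha⟩ := Multiset.card_pos_iff_exists_mem.1 (by omega : 0 < U.card)
      have hfin : ∀ g ∈ U, ∃ z, color χ g = some z := fun g hg =>
        Option.ne_none_iff_exists'.1 fun h => hU g hg (color_eq_none_iff.1 h)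
      obtain ⟨z, hz⟩ := hfin a ha
      have hsplit := card_eq_countP_add (color χ) U (some z)
      by_cases hb : ∃ b ∈ U, color χ b ≠ color χ a
      · obtain ⟨b, hb, hba⟩ := hb
        obtain ⟨y, hy⟩ := hfin b hb
        have h5 : U.countP (fun g => color χ g ≠ some z) ≤
            U.countP (fun g => color χ g = some y) := by
          rw [Multiset.countP_eq_card_filter, Multiset.countP_eq_card_filter]
          refine Multiset.card_le_card ?_
          rw [Multiset.le_filter]
          refine ⟨Multiset.filter_le _ _, fun g hg => ?_⟩
          obtain ⟨hg1, hg2⟩ := Multiset.mem_filter.1 hg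
          rw [← hy]
          by_contra hgb
          exact hg2 ((h3 a ha b hb g hg1 hba.symm (Ne.symm hgb)).symm.trans hz)
        rcases le_total (U.countP (fun g => color χ g = some z))
          (U.countP (fun g => color χ g = some y)) with h | h
        · exact ⟨y, by omega⟩
        · exact ⟨z, by omega⟩
      · push Not at hb
        refine ⟨z, ?_⟩
        rw [Multiset.countP_eq_card.2 fun g hg => (hb g hg).trans hz]
        omega
    set F := U.filter (fun g => color χ g = some z) with hF
    have hFc : F.card = U.countP (fun g => color χ g = some z) :=
      (Multiset.countP_eq_card_filter _ _).symm
    have h5 := hcol z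
    rw [← hFc] at hz h5
    have h6 := card_prefixTw (l := F.toList) (by
      rw [Multiset.coe_toList]; exact hfree z)
    have h7 := card_Pr_of_prefixes hχ F.toList (prefixTw F.toList)
      (Finset.card_pos.1 (by omega)) (fun α hα => exists_of_mem_prefixTw hα) T hT
    rw [h6, Multiset.length_toList, Multiset.coe_toList, Nat.add_sub_cancel] at h7
    refine Pr_univ_mono (add_le_add (Multiset.filter_le _ _) le_rfl : F + T ≤ U + T)
      (Pr_eq_univ_iff.2 ?_)
    -- `1 + t * a ≥ q` follows from `t + 2 * a ≥ q` and `2 ≤ a ≤ (q - 3) / 2`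
    have h8 : q ≤ T.card + 2 * F.card := by omega
    have h9 : q ≤ 1 + T.card * F.card := by
      obtain ⟨r, hr⟩ : ∃ r, F.card = r + 2 := ⟨F.card - 2, by omega⟩
      obtain ⟨s, hs⟩ : ∃ s, T.card = s + 3 := ⟨T.card - 3, by omega⟩
      rw [hr, hs] at h8 ⊢
      nlinarith [Nat.zero_le (s * r)]
    omega

/-- A product-one sequence of length `2 * q` over `ZMod q ⋊ ZMod p`, without the identity and with
at least three terms of non-zero twist, splits into two non-empty product-one sequences. -/
theorem exists_split (hp : Odd p) (hq : Odd q) (hχ : Function.Injective χ) (hdvd : p ∣ q - 1)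
    {S : Multiset (Elt p q)} (hS : ∀ g ∈ S, g ≠ 0) (hcard : S.card = 2 * q) (hPO : PO χ S)
    (h3 : 3 ≤ S.countP (fun g => g.2 ≠ 0)) :
    ∃ A B : Multiset (Elt p q), A ≠ 0 ∧ B ≠ 0 ∧ PO χ A ∧ PO χ B ∧ S = A + B := by
  have hp3 : 3 ≤ p := by
    have := (Fact.out : p.Prime).two_le
    obtain ⟨k, hk⟩ := hp
    omega
  obtain ⟨k, hk⟩ := hdvd
  have hq2 := (Fact.out : q.Prime).two_le
  have hpq : 2 * p + 1 ≤ q := by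
    have h1 : k ≠ 0 := by rintro rfl; omega
    have h2 : k ≠ 1 := by
      rintro rfl
      obtain ⟨a, ha⟩ := hp
      obtain ⟨b, hb⟩ := hq
      omega
    have : p * 2 ≤ p * k := Nat.mul_le_mul_left _ (by omega)
    omega
  -- a colour used by more than half of the terms
  by_cases hpop : ∃ z, q + 1 ≤ S.countP (fun g => color χ g = some z)
  · obtain ⟨z, hz⟩ := hpop
    exact exists_split_of_popular hp hq hχ hpq hS hcard hPO hz
  push Not at hpop
  set U := S.filter (fun g => g.2 ≠ 0) with hUdef
  set T := S.filter (fun g => ¬ g.2 ≠ 0) with hTdef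
  have hST : S = U + T := (Multiset.filter_add_not _ _).symm
  have hU : ∀ g ∈ U, g.2 ≠ 0 := fun g hg => (Multiset.mem_filter.1 hg).2
  have hT : ∀ g ∈ T, g.2 = 0 ∧ g.1 ≠ 0 := fun g hg => by
    obtain ⟨h1, h2⟩ := Multiset.mem_filter.1 hg
    rw [not_not] at h2
    exact ⟨h2, fun h => hS g h1 (Prod.ext h h2)⟩
  have hTtw : tw T = 0 := by
    unfold tw
    apply Multiset.sum_eq_zero
    intro x hx
    obtain ⟨g, hg, rfl⟩ := Multiset.mem_map.1 hx
    exact (hT g hg).1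
  have hU3 : 3 ≤ U.card := by rwa [Multiset.countP_eq_card_filter] at h3
  have hUS : U ≤ S := Multiset.filter_le _ _
  have hcUT : U.card + T.card = 2 * q := by rw [← Multiset.card_add, ← hST, hcard]
  have hUtw : tw U = 0 := by
    have := hPO.1
    rwa [hST, tw_add, hTtw, add_zero] at this
  -- a zero-sum sub-sequence of one colour which is not all of `U`
  by_cases hmono : ∃ N ≤ U, N ≠ 0 ∧ N ≠ U ∧ tw N = 0 ∧ ∃ z, ∀ g ∈ N, color χ g = some z
  · obtain ⟨N, hNU, hN0, hNne, hNtw, z, hNz⟩ := hmono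
    obtain ⟨A, hAN, hA0, hAp, hAtw⟩ : ∃ A ≤ N, A ≠ 0 ∧ A.card ≤ p ∧ tw A = 0 := by
      by_cases h : p ≤ N.card
      · exact exists_tw_eq_zero h
      · exact ⟨N, le_rfl, hN0, by omega, hNtw⟩
    have hAPO : PO χ A := PO_of_color hχ (fun g hg => hNz g (Multiset.mem_of_le hAN hg)) hAtw
    obtain ⟨U₂, hU₂⟩ := Multiset.le_iff_exists_add.1 (hAN.trans hNU)
    have hU₂0 : U₂ ≠ 0 := by
      rintro rfl
      rw [add_zero] at hU₂
      exact hNne (le_antisymm hNU (hU₂ ▸ hAN))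
    have hU₂U : U₂ ≤ U := hU₂ ▸ Multiset.le_add_left _ _
    have hU₂tw : tw U₂ = 0 := by
      rw [hU₂, tw_add, hAtw, zero_add] at hUtw
      exact hUtw
    have hU₂c : A.card + U₂.card = U.card := by rw [hU₂, Multiset.card_add]
    suffices h : Pr χ (U₂ + T) = Finset.univ by
      refine ⟨A, U₂ + T, hA0, fun h' => hU₂0 ?_, hAPO,
        ⟨by rw [tw_add, hU₂tw, hTtw, add_zero], by rw [h]; exact Finset.mem_univ _⟩, ?_⟩
      · exact (add_eq_zero.1 h').1
      · rw [hST, hU₂, add_assoc]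
    by_cases ht : q ≤ 1 + T.card
    · obtain ⟨g, hg⟩ := Multiset.exists_mem_of_ne_zero hU₂0
      exact Pr_univ_mono (add_le_add (Multiset.singleton_le.2 hg) le_rfl)
        (Pr_univ_of_two_prefixes hχ (hU g (Multiset.mem_of_le hU₂U hg)) hT ht)
    · have hle : U₂ + T ≤ S := by rw [hST]; exact add_le_add hU₂U le_rfl
      refine Pr_univ_of_colors hp hq (by omega) hχ
        (fun g hg => hS g (Multiset.mem_of_le hle hg)) (by rw [Multiset.card_add]; omega) ?_
      intro b
      rcases b with _ | y
      · have h1 : U₂.countP (fun g => color χ g ≠ none) = U₂.card :=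
          Multiset.countP_eq_card.2 fun g hg h =>
            hU g (Multiset.mem_of_le hU₂U hg) (color_eq_none_iff.1 h)
        rw [Multiset.countP_add]
        omega
      · have h1 := card_eq_countP_add (color χ) (U₂ + T) (some y)
        have h2 := Multiset.countP_le_of_le (fun g => color χ g = some y) hle
        have h4 := hpop y
        rw [Multiset.card_add] at h1
        omega
  push Not at hmono
  have hfree : ∀ N ≤ U, N ≠ 0 → N.card < U.card → (∃ z, ∀ g ∈ N, color χ g = some z) →
      tw N ≠ 0 := by
    rintro N hN hN0 hNc ⟨z, hz⟩ htw
    obtain ⟨g, hg, hgz⟩ := hmono N hN hN0 (fun h => by rw [h] at hNc; omega) htw z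
    exact hgz (hz g hg)
  have hcolp : p < U.card → ∀ z, U.countP (fun g => color χ g = some z) + 1 ≤ p := by
    intro hpU z
    by_contra hcon
    obtain ⟨N, hN, hN0, hNp, hNtw⟩ := exists_tw_eq_zero
      (M := U.filter (fun g => color χ g = some z))
      (by rw [← Multiset.countP_eq_card_filter]; omega)
    exact hfree N (hN.trans (Multiset.filter_le _ _)) hN0 (by omega)
      ⟨z, fun g hg => (Multiset.mem_filter.1 (Multiset.mem_of_le hN hg)).2⟩ hNtw
  have hblocks : ∀ Bs : List (Multiset (Elt p q)), (∀ B ∈ Bs, tw B = 0 ∧ B.card = p) →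
      tw Bs.sum = 0 ∧ Bs.sum.card = Bs.length * p := by
    intro Bs
    induction Bs with
    | nil => intro _; simp
    | cons B Bs ih =>
      intro h
      obtain ⟨h1, h2⟩ := ih fun C hC => h C (List.mem_cons_of_mem _ hC)
      obtain ⟨h4, h5⟩ := h B List.mem_cons_self
      refine ⟨by rw [List.sum_cons, tw_add, h1, h4, add_zero], ?_⟩
      rw [List.sum_cons, Multiset.card_add, h2, h5, List.length_cons]
      ring
  -- now every colour is zero-sum free, except when it exhausts `U`
  rcases Nat.eq_zero_or_pos T.card with ht0 | ht1
  · -- without terms of twist zero: `q - 1` terms in blocks of length `p`, and the `q + 1` others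
    have hT0 : T = 0 := Multiset.card_eq_zero.1 ht0
    rw [hT0, add_zero] at hST
    have hkp : k * p = q - 1 := by rw [hk, mul_comm]
    obtain ⟨Bs, hBs1, hBs2, hBs3⟩ := exists_blocks k U (by omega)
    obtain ⟨hW1, hW2⟩ := hblocks Bs hBs2
    set W := Bs.sum with hW
    obtain ⟨V, hV⟩ := Multiset.le_iff_exists_add.1 hBs3
    rw [hBs1, hkp] at hW2
    have hcol := hcolp (by omega)
    have hVU : V ≤ U := hV ▸ Multiset.le_add_left _ _
    have hVc : V.card = q + 1 := by
      have := congrArg Multiset.card hV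
      rw [Multiset.card_add] at this
      omega
    have hnone : ∀ M ≤ U, M.countP (fun g => color χ g = none) = 0 := by
      intro M hM
      rw [Multiset.countP_eq_zero]
      intro g hg h
      exact hU g (Multiset.mem_of_le hM hg) (color_eq_none_iff.1 h)
    have hWfull : Pr χ W = Finset.univ := by
      refine Pr_univ_of_colors_twist hp hq (by omega) hχ
        (fun g hg => hU g (Multiset.mem_of_le hBs3 hg)) (by omega) ?_
      intro b
      rcases b with _ | z
      · rw [hnone W hBs3]; omega
      · have h1 := hcol z
        have h2 := Multiset.countP_le_of_le (fun g => color χ g = some z) hBs3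
        omega
    have hVfull : Pr χ V = Finset.univ := by
      refine Pr_univ_of_colors hp hq (by omega) hχ
        (fun g hg => hS g (Multiset.mem_of_le (hVU.trans hUS) hg)) (by omega) ?_
      intro b
      have h3 := card_eq_countP_add (color χ) V b
      rcases b with _ | z
      · rw [hnone V hVU] at h3; omega
      · have h1 := hcol z
        have h2 := Multiset.countP_le_of_le (fun g => color χ g = some z) hVU
        omega
    have hVtw : tw V = 0 := by
      rw [hV, tw_add, hW1, zero_add] at hUtw
      exact hUtw
    refine ⟨W, V, ?_, ?_, ⟨hW1, by rw [hWfull]; exact Finset.mem_univ _⟩,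
      ⟨hVtw, by rw [hVfull]; exact Finset.mem_univ _⟩, by rw [hST, hV]⟩
    · exact Multiset.card_pos.1 (by omega)
    · exact Multiset.card_pos.1 (by omega)
  · -- blocks of length `p` and terms of twist zero of total length `q`, and the `q` others
    obtain ⟨a, Bs, hBs2, hBs3, hBsc, haq, haT, haU⟩ : ∃ a, ∃ Bs : List (Multiset (Elt p q)),
        (∀ B ∈ Bs, tw B = 0 ∧ B.card = p) ∧ Bs.sum ≤ U ∧ Bs.sum.card = a ∧ a ≤ q ∧
        q ≤ a + T.card ∧ a + 3 ≤ U.card := by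
      -- as many blocks as the Erdős–Ginzburg–Ziv theorem provides, but at most `k = (q - 1) / p`
      by_cases hk' : k * p + p ≤ U.card
      · obtain ⟨Bs, h1, h2, h4⟩ := exists_blocks k U hk'
        have hkp : k * p = q - 1 := by rw [hk, mul_comm]
        exact ⟨k * p, Bs, h2, h4, by rw [(hblocks Bs h2).2, h1], by omega, by omega, by omega⟩
      · have hkp : k * p = q - 1 := by rw [hk, mul_comm]
        by_cases hUp : U.card < 2 * p
        · exact ⟨0, [], by simp, by simp, by simp, by omega, by omega, by omega⟩
        · obtain ⟨j, hj⟩ : ∃ j, U.card / p = j + 1 :=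
            ⟨U.card / p - 1, by
              have : 1 ≤ U.card / p := (Nat.one_le_div_iff (by omega)).2 (by omega)
              omega⟩
          have h1 := Nat.div_mul_le_self U.card p
          have h2 := Nat.lt_div_mul_add (a := U.card) (b := p) (by omega)
          rw [hj, Nat.add_mul, one_mul] at h1 h2
          obtain ⟨Bs, h4, h5, h6⟩ := exists_blocks j U h1
          exact ⟨j * p, Bs, h5, h6, by rw [(hblocks Bs h5).2, h4], by omega, by omega, by omega⟩
    obtain ⟨UV, hUV⟩ := Multiset.le_iff_exists_add.1 hBs3
    obtain ⟨TW, hTW, hTWc⟩ := exists_le_card (M := T) (n := q - a) (by omega)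
    obtain ⟨TV, hTV⟩ := Multiset.le_iff_exists_add.1 hTW
    have hUVU : UV ≤ U := hUV ▸ Multiset.le_add_left _ _
    have hTVT : TV ≤ T := hTV ▸ Multiset.le_add_left _ _
    have hUVc : a + UV.card = U.card := by
      have := congrArg Multiset.card hUV
      rw [Multiset.card_add, hBsc] at this
      exact this.symm
    have hTVc : TW.card + TV.card = T.card := by
      have := congrArg Multiset.card hTV
      rw [Multiset.card_add] at this
      exact this.symm
    have hVfull : Pr χ (UV + TV) = Finset.univ := by
      have hUV' : ∀ g ∈ UV, g.2 ≠ 0 := fun g hg => hU g (Multiset.mem_of_le hUVU hg)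
      have hTV' : ∀ g ∈ TV, g.2 = 0 ∧ g.1 ≠ 0 := fun g hg => hT g (Multiset.mem_of_le hTVT hg)
      by_cases hTVq : q ≤ 1 + 2 * TV.card
      · exact Pr_univ_of_three_prefixes hp hχ hUV' (by omega) hTV' hTVq
      · have hTVq' : 2 * TV.card + 3 ≤ q := by obtain ⟨b, hb⟩ := hq; omega
        have hcol := hcolp (by omega)
        have hcol' : ∀ z, UV.countP (fun g => color χ g = some z) + 1 ≤ p := fun z =>
          (Nat.add_le_add_right (Multiset.countP_le_of_le _ hUVU) 1).trans (hcol z)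
        refine Pr_univ_of_few_colors hp hq hχ hpq hUV' hTV' (by omega) hTVq' hcol' ?_
        intro z N hN hN0
        have h1 := Multiset.card_le_card hN
        rw [← Multiset.countP_eq_card_filter] at h1
        have h2 := hcol' z
        exact hfree N ((hN.trans (Multiset.filter_le _ _)).trans hUVU) hN0 (by omega)
          ⟨z, fun g hg => (Multiset.mem_filter.1 (Multiset.mem_of_le hN hg)).2⟩
    have hsingle : (TW.toList.map fun g => ({g} : Multiset (Elt p q))).sum = TW := by
      conv_rhs => rw [← Multiset.coe_toList TW]
      induction TW.toList with
      | nil => rfl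
      | cons g l ih => rw [List.map_cons, List.sum_cons, ih, Multiset.singleton_add,
          Multiset.cons_coe]
    have hsum : (Bs ++ TW.toList.map fun g => ({g} : Multiset (Elt p q))).sum = Bs.sum + TW := by
      rw [List.sum_append, hsingle]
    obtain ⟨A, hA, hA0, hAPO⟩ := exists_PO_le_sum (χ := χ)
      (Bs ++ TW.toList.map fun g => ({g} : Multiset (Elt p q))) (by
        intro B hB
        rcases List.mem_append.1 hB with hB | hB
        · obtain ⟨h1, h2⟩ := hBs2 B hB
          refine ⟨h1, by omega, PO_or_le_card_Pr hχ (fun g hg => hU g ?_) h1 h2⟩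
          exact Multiset.mem_of_le ((List.single_le_sum (by simp) _ hB).trans hBs3) hg
        · obtain ⟨g, hg, rfl⟩ := List.mem_map.1 hB
          rw [Multiset.mem_toList] at hg
          exact ⟨by rw [tw_singleton, (hT g (Multiset.mem_of_le hTW hg)).1], by simp,
            Or.inr (by simp [Pr_singleton])⟩)
      (by rw [hsum, Multiset.card_add]; omega)
    rw [hsum] at hA
    obtain ⟨A', hA'⟩ := Multiset.le_iff_exists_add.1 hA
    have hSA : S = A + (A' + (UV + TV)) := by
      rw [hST, hUV, hTV, ← add_assoc A, ← hA']
      abel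
    refine ⟨A, A' + (UV + TV), hA0, ?_, hAPO, ⟨?_, ?_⟩, hSA⟩
    · intro h
      have := congrArg Multiset.card h
      simp only [Multiset.card_add, Multiset.card_zero] at this
      omega
    · have := hPO.1
      rwa [hSA, tw_add, hAPO.1, zero_add] at this
    · rw [Pr_univ_mono (Multiset.le_add_left _ _) hVfull]
      exact Finset.mem_univ _

end Splitting

/-! ### Coordinates on a non-abelian group of order `p * q` -/

section Coordinates

variable {p q : ℕ} [Fact p.Prime] [Fact q.Prime] {χ : AddChar (ZMod p) (ZMod q)}

/-- A non-abelian group of order `p * q`, where `p < q` are primes, is a semidirect product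
`ZMod q ⋊ ZMod p`, with a faithful action of `ZMod p`. -/
theorem exists_coordinates {G : Type*} [Group G] (hpq : p < q) (hcard : Nat.card G = p * q)
    (hnonab : ∃ a b : G, a * b ≠ b * a) :
    ∃ (χ : AddChar (ZMod p) (ZMod q)) (e : G ≃ Elt p q), Function.Injective χ ∧
      ∀ g h, e (g * h) = ((e g).1 + χ (e g).2 * (e h).1, (e g).2 + (e h).2) := by
  have hp : p.Prime := Fact.out
  have hq : q.Prime := Fact.out
  have hfin : Finite G := Nat.finite_of_card_ne_zero (by
    rw [hcard]; exact Nat.mul_ne_zero hp.ne_zero hq.ne_zero)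
  obtain ⟨x, hx⟩ := exists_prime_orderOf_dvd_card' (G := G) q (hcard ▸ Nat.dvd_mul_left _ _)
  obtain ⟨y, hy⟩ := exists_prime_orderOf_dvd_card' (G := G) p (hcard ▸ Nat.dvd_mul_right _ _)
  -- the Sylow subgroup generated by `x` is normal, since its index is the least prime factor
  have hnormal : (Subgroup.zpowers x).Normal := by
    apply Subgroup.normal_of_index_eq_minFac_card
    have h1 := (Subgroup.zpowers x).card_mul_index
    rw [Nat.card_zpowers, hx, hcard, mul_comm p q] at h1
    rw [Nat.eq_of_mul_eq_mul_left hq.pos h1, hcard]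
    refine le_antisymm ?_ (Nat.minFac_le_of_dvd hp.two_le (Nat.dvd_mul_right _ _))
    have h2 := Nat.minFac_prime (n := p * q) (by
      intro h; exact hp.one_lt.ne' (Nat.eq_one_of_mul_eq_one_right h))
    rcases (h2.dvd_mul).1 (Nat.minFac_dvd (p * q)) with h | h
    · exact ((Nat.prime_dvd_prime_iff_eq h2 hp).1 h).ge
    · exact hpq.le.trans ((Nat.prime_dvd_prime_iff_eq h2 hq).1 h).ge
  obtain ⟨r, hr⟩ : ∃ r : ℕ, x ^ r = y * x * y⁻¹ :=
    (isOfFinOrder_of_finite x).mem_powers_iff_mem_zpowers.2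
      (hnormal.conj_mem x (Subgroup.mem_zpowers x) y)
  have hyx : ∀ m : ℕ, y * x ^ m = x ^ (r * m) * y := fun m => by
    rw [pow_mul, hr, conj_pow, inv_mul_cancel_right]
  have hyx' : ∀ n m : ℕ, y ^ n * x ^ m = x ^ (r ^ n * m) * y ^ n := by
    intro n
    induction n with
    | zero => intro m; simp
    | succ n ih =>
      intro m
      rw [pow_succ', mul_assoc, ih, ← mul_assoc, hyx, mul_assoc, pow_succ', mul_assoc r]
  have hxy : ∀ m n : ℕ, x ^ m = x ^ n ↔ (m : ZMod q) = n := fun m n => by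
    rw [pow_eq_pow_iff_modEq, hx, ZMod.natCast_eq_natCast_iff]
  have hrp : (r : ZMod q) ^ p = 1 := by
    have h1 := hyx' p 1
    rw [← hy, pow_orderOf_eq_one, one_mul, mul_one, mul_one, hxy, hy] at h1
    rw [← Nat.cast_pow, ← h1, Nat.cast_one]
  set χ : AddChar (ZMod p) (ZMod q) := AddChar.zmodChar p hrp with hχ
  set X : ZMod q → G := fun a => x ^ a.val with hX
  set Y : ZMod p → G := fun b => y ^ b.val with hY
  have hXn : ∀ n : ℕ, X n = x ^ n := fun n => by
    rw [hX]; simp only [ZMod.val_natCast]; rw [← hx, pow_mod_orderOf]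
  have hYn : ∀ n : ℕ, Y n = y ^ n := fun n => by
    rw [hY]; simp only [ZMod.val_natCast]; rw [← hy, pow_mod_orderOf]
  have hXadd : ∀ a b, X (a + b) = X a * X b := fun a b => by
    obtain ⟨m, rfl⟩ := ZMod.natCast_zmod_surjective a
    obtain ⟨n, rfl⟩ := ZMod.natCast_zmod_surjective b
    rw [← Nat.cast_add, hXn, hXn, hXn, pow_add]
  have hYadd : ∀ a b, Y (a + b) = Y a * Y b := fun a b => by
    obtain ⟨m, rfl⟩ := ZMod.natCast_zmod_surjective a
    obtain ⟨n, rfl⟩ := ZMod.natCast_zmod_surjective b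
    rw [← Nat.cast_add, hYn, hYn, hYn, pow_add]
  have hYX : ∀ b c, Y b * X c = X (χ b * c) * Y b := fun b c => by
    have h1 : χ b * c = ((r ^ b.val * c.val : ℕ) : ZMod q) := by
      rw [hχ, AddChar.zmodChar_apply]
      simp
    rw [h1, hXn]
    exact hyx' _ _
  set ψ : Elt p q → G := fun u => X u.1 * Y u.2 with hψ
  have hmul : ∀ u v : Elt p q, ψ u * ψ v = ψ (u.1 + χ u.2 * v.1, u.2 + v.2) := fun u v => by
    simp only [hψ]
    rw [hXadd, hYadd, mul_assoc, ← mul_assoc (Y u.2), hYX]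
    simp only [mul_assoc]
  have hX0 : ∀ a, X a = 1 → a = 0 := fun a ha => by
    have h1 : x ^ a.val = x ^ 0 := by rw [pow_zero]; exact ha
    rw [hxy] at h1
    simpa using h1
  have hY0 : ∀ b, Y b = 1 → b = 0 := fun b hb => by
    have h1 : p ∣ b.val := by
      have h2 : orderOf y ∣ b.val := orderOf_dvd_of_pow_eq_one hb
      rwa [hy] at h2
    rw [← ZMod.natCast_eq_zero_iff] at h1
    simpa using h1
  have hinj : Function.Injective ψ := by
    rintro ⟨a, b⟩ ⟨c, d⟩ h
    have h : X a * Y b = X c * Y d := h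
    have h1 : X (a - c) = Y (d - b) := by
      have e1 : X a = X c * X (a - c) := by rw [← hXadd]; congr 1; ring
      have e2 : Y d = Y (d - b) * Y b := by rw [← hYadd]; congr 1; ring
      rw [e1, e2, mul_assoc, mul_right_inj] at h
      exact mul_right_cancel h
    have hq1 : X (a - c) ^ q = 1 := by
      simp only [hX]; rw [← pow_mul, mul_comm, pow_mul, orderOf_dvd_iff_pow_eq_one.1 hx.dvd, one_pow]
    have hp1 : X (a - c) ^ p = 1 := by
      rw [h1]; simp only [hY]
      rw [← pow_mul, mul_comm, pow_mul, orderOf_dvd_iff_pow_eq_one.1 hy.dvd, one_pow]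
    have h2 : X (a - c) = 1 := by
      have h3 := Nat.dvd_gcd (orderOf_dvd_of_pow_eq_one hp1) (orderOf_dvd_of_pow_eq_one hq1)
      rw [(Nat.coprime_primes hp hq).2 hpq.ne] at h3
      exact orderOf_eq_one_iff.1 (Nat.dvd_one.1 h3)
    have h3 := hX0 _ h2
    have h4 := hY0 _ (h1 ▸ h2)
    rw [sub_eq_zero] at h3 h4
    rw [h3, h4]
  have hbij : Function.Bijective ψ := by
    rw [Nat.bijective_iff_injective_and_card]
    refine ⟨hinj, ?_⟩
    rw [hcard, Nat.card_prod, Nat.card_zmod, Nat.card_zmod, mul_comm]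
  refine ⟨χ, (Equiv.ofBijective ψ hbij).symm, ?_, ?_⟩
  · have hr1 : (r : ZMod q) ≠ 1 := by
      intro h1
      have hχ1 : ∀ b, χ b = 1 := fun b => by rw [hχ, AddChar.zmodChar_apply, h1, one_pow]
      obtain ⟨a, b, hab⟩ := hnonab
      obtain ⟨u, rfl⟩ := hbij.2 a
      obtain ⟨v, rfl⟩ := hbij.2 b
      apply hab
      rw [hmul, hmul, hχ1, hχ1, one_mul, one_mul, add_comm u.1, add_comm u.2]
    intro b c hbc
    rw [hχ, AddChar.zmodChar_apply, AddChar.zmodChar_apply] at hbc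
    have hord := orderOf_eq_prime hrp hr1
    exact ZMod.val_injective p (pow_injOn_Iio_orderOf
      (by rw [Set.mem_Iio, hord]; exact ZMod.val_lt b)
      (by rw [Set.mem_Iio, hord]; exact ZMod.val_lt c) hbc)
  · intro g h
    rw [Equiv.symm_apply_eq, Equiv.ofBijective_apply, ← hmul]
    rw [← Equiv.ofBijective_apply ψ hbij, ← Equiv.ofBijective_apply ψ hbij,
      Equiv.apply_symm_apply, Equiv.apply_symm_apply]

section Transfer

variable {G : Type*} [Group G] {e : G ≃ Elt p q}

lemma coord_one
    (he : ∀ g h, e (g * h) = ((e g).1 + χ (e g).2 * (e h).1, (e g).2 + (e h).2)) :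
    e 1 = 0 := by
  have h := he 1 1
  rw [one_mul] at h
  have h2 : (e 1).2 = 0 := by simpa using congrArg Prod.snd h
  have h1 : (e 1).1 = 0 := by simpa [h2] using congrArg Prod.fst h
  exact Prod.ext h1 h2

lemma coord_prod
    (he : ∀ g h, e (g * h) = ((e g).1 + χ (e g).2 * (e h).1, (e g).2 + (e h).2))
    (l : List G) :
    e l.prod = (ev χ (l.map e), tw ((l.map e : List (Elt p q)) : Multiset (Elt p q))) := by
  induction l with
  | nil => rw [List.prod_nil, coord_one he]; rfl
  | cons g l ih => rw [List.prod_cons, he, ih]; simp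

/-- Product-one sequences over `G` correspond to those over `ZMod q ⋊ ZMod p`. -/
lemma isProductOne_iff
    (he : ∀ g h, e (g * h) = ((e g).1 + χ (e g).2 * (e h).1, (e g).2 + (e h).2))
    (S : Multiset G) : IsProductOne S ↔ PO χ (S.map e) := by
  constructor
  · rintro ⟨l, rfl, hl⟩
    have h := coord_prod he l
    rw [hl, coord_one he] at h
    rw [Multiset.map_coe]
    exact ⟨(congrArg Prod.snd h).symm, mem_Pr.2 ⟨l.map e, rfl, (congrArg Prod.fst h).symm⟩⟩
  · rintro ⟨h1, h2⟩
    obtain ⟨l, hl, h3⟩ := mem_Pr.1 h2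
    have hmap : (l.map e.symm).map e = l := by simp
    refine ⟨l.map e.symm, ?_, ?_⟩
    · rw [← Multiset.map_coe, hl]; simp
    · apply e.injective
      rw [coord_prod he, hmap, coord_one he, h3, hl, h1]
      rfl

/-- The commutator subgroup of `ZMod q ⋊ ZMod p` consists of the elements of twist zero: if
`(χ 1 - 1) * m = c` then `(c, 0)` is the commutator of `(0, 1)` and `(m, 0)`. -/
lemma mem_commutator_iff (hχ : Function.Injective χ)
    (he : ∀ g h, e (g * h) = ((e g).1 + χ (e g).2 * (e h).1, (e g).2 + (e h).2))
    (g : G) :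
    g ∈ commutator G ↔ (e g).2 = 0 := by
  constructor
  · intro hg
    let f : G →* Multiplicative (ZMod p) :=
      { toFun := fun g => Multiplicative.ofAdd (e g).2
        map_one' := by rw [coord_one he]; rfl
        map_mul' := fun g h => by rw [he]; rfl }
    exact Abelianization.commutator_subset_ker f hg
  · intro hg
    have h1 : χ 1 - 1 ≠ 0 := by
      rw [sub_ne_zero, ← AddChar.map_zero_eq_one χ]
      exact fun h => one_ne_zero (hχ h)
    set h := e.symm ((0, 1) : Elt p q) with hh
    set k := e.symm (((e g).1 / (χ 1 - 1), 0) : Elt p q) with hk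
    have h2 : h * k = g * k * h := by
      apply e.injective
      rw [he, he, he, hh, hk, hg]
      simp only [Equiv.apply_symm_apply, AddChar.map_zero_eq_one]
      ext
      · simp only; field_simp; ring
      · simp
    have h3 : g = h * k * h⁻¹ * k⁻¹ := by
      rw [h2]; group
    rw [h3, ← commutatorElement_def]
    exact Subgroup.commutator_mem_commutator (Subgroup.mem_top _) (Subgroup.mem_top _)

end Transfer

lemma isProductOne_erase_one {G : Type*} [Group G] [DecidableEq G] {S : Multiset G}
    (h : IsProductOne S) : IsProductOne (S.erase 1) := by
  obtain ⟨l, rfl, hl⟩ := h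
  refine ⟨l.erase 1, by simp, ?_⟩
  suffices h : (l.erase 1).prod = l.prod from h.trans hl
  clear hl
  induction l with
  | nil => rfl
  | cons g l ih =>
    by_cases hg : g = 1
    · rw [hg, List.erase_cons_head, List.prod_cons, one_mul]
    · rw [List.erase_cons_tail (by simpa using hg), List.prod_cons, List.prod_cons, ih]

lemma numTermsIn_eq_countP {G : Type*} {K : Set G} {P : G → Prop} [DecidablePred P]
    (S : Multiset G) (h : ∀ g, g ∈ K ↔ P g) : numTermsIn K S = S.countP P := by
  obtain rfl : (fun g => g ∈ K) = P := funext fun g => propext (h g)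
  unfold numTermsIn
  congr!

end Coordinates

end SemidirectSeq

open SemidirectSeq

theorem theorem4p1 {G : Type*} [Group G] (p q : ℕ) (hp : p.Prime) (hq : q.Prime)
    (hp_odd : Odd p) (hq_odd : Odd q) (hpq : p ∣ q - 1)
    (hcard : Nat.card G = p * q) (hnonab : ∃ a b : G, a * b ≠ b * a)
    (S : Multiset G) (hlen : S.card = 2 * q) :
    (3 ≤ numTermsIn ((commutator G : Set G)ᶜ) S → ¬ IsMinimalProductOne S) ∧
      (IsMinimalProductOne S → numTermsIn ((commutator G : Set G)ᶜ) S ≤ 2) := by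
  have key : 3 ≤ numTermsIn ((commutator G : Set G)ᶜ) S → ¬ IsMinimalProductOne S := by
    classical
    rintro h3 ⟨hPO, hmin⟩
    have : Fact p.Prime := ⟨hp⟩
    have : Fact q.Prime := ⟨hq⟩
    have hq2 := hq.two_le
    by_cases h1 : (1 : G) ∈ S
    · refine hmin {1} (S.erase 1) (by simp) ?_ ⟨[1], rfl, by simp⟩
        (isProductOne_erase_one hPO) ?_
      · rw [← Multiset.card_pos, Multiset.card_erase_of_mem h1, Nat.pred_eq_sub_one]
        omega
      · rw [Multiset.singleton_add, Multiset.cons_erase h1]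
    have hlt : p < q := by
      have := Nat.le_of_dvd (by omega) hpq
      omega
    obtain ⟨χ, e, hχ, he⟩ := exists_coordinates hlt hcard hnonab
    obtain ⟨A, B, hA, hB, hAPO, hBPO, hAB⟩ := exists_split hp_odd hq_odd hχ hpq
      (S := S.map e) (fun g hg => by
        obtain ⟨a, ha, rfl⟩ := Multiset.mem_map.1 hg
        rw [← coord_one he]
        exact fun h => h1 (e.injective h ▸ ha)) (by rw [Multiset.card_map, hlen])
      ((isProductOne_iff he S).1 hPO) (by
        rw [Multiset.countP_map, ← Multiset.countP_eq_card_filter]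
        refine h3.trans (le_of_eq ?_)
        exact numTermsIn_eq_countP S fun g => by
          rw [Set.mem_compl_iff, SetLike.mem_coe, mem_commutator_iff hχ he])
    have hmap : ∀ C : Multiset (Elt p q), (C.map e.symm).map e = C := fun C => by simp
    refine hmin (A.map e.symm) (B.map e.symm) (by simpa using hA) (by simpa using hB)
      ((isProductOne_iff he _).2 (by rwa [hmap])) ((isProductOne_iff he _).2 (by rwa [hmap])) ?_
    rw [← Multiset.map_add, ← hAB]
    simp
  exact ⟨key, fun h => by
    by_contra hcon
    exact key (by omega) h⟩
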